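/- Let $A,B$ be nonzero finite-dimensional complex Hilbert spaces with fixed orthonormal bases, let $\mathcal N_{A\to B}$ be a quantum channel (a completely positive trace-preserving linear map) with Choi matrix $J_{\mathcal N}=\sum_{i,j}|i\rangle\langle j|\otimes\mathcal N(|i\rangle\langle j|)$, let $m\ge 1$ be an integer and let $\mathrm{id}_m$ be the identity channel on operators on $\mathbb C^m$. A code for simulating $\mathcal N$ from $\mathrm{id}_m$ is a bipartite quantum channel $\Pi_{A_iB_i\to A_oB_o}$ with $A_i=A$, $B_o=B$, $A_o=B_i=\mathbb C^m$. It is an NS code if it is no-signalling in both directions: $\mathrm{tr}_{A_o}\Pi(\rho_1\otimes\sigma)=\mathrm{tr}_{A_o}\Pi(\rho_2\otimes\sigma)$ for all states $\rho_1,\rho_2$ on $A_i$ and operators $\sigma$ on $B_i$, and $\mathrm{tr}_{B_o}\Pi(\rho\otimes\sigma_1)=\mathrm{tr}_{B_o}\Pi(\rho\otimes\sigma_2)$ for all states $\sigma_1,\sigma_2$ on $B_i$ and operators $\rho$ on $A_i$. It is a PPT code if it satisfies the second of these conditions and its Choi matrix satisfies $J_\Pi^{T_{B_iB_o}}\ge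 0$. For a channel $\mathcal M_{A_o\to B_i}$, $\Pi\circ\mathcal M$ denotes the effective map $A_i\to B_o$ obtained by feeding the output $A_o$ of $\Pi$ through $\mathcal M$ into its input $B_i$. For $\Omega\in\{\mathrm{NS},\ \mathrm{NS}\cap\mathrm{PPT}\}$ put $$\omega_\Omega(\mathrm{id}_m,\mathcal N)=\tfrac12\inf_{\Pi\in\Omega}\|\Pi\circ\mathrm{id}_m-\mathcal N\|_\diamondsuit,\qquad \|\mathcal F\|_\diamondsuit=\sup_{k\in\mathbb N}\ \sup_{\|X\|_1\le1}\|(\mathcal F\otimes\mathrm{id}_k)(X)\|_1 .$$ Then $\omega_{\mathrm{NS}}(\mathrm{id}_m,\mathcal N)$ is finite and equals the optimal value of the semidefinite program, over $\gamma\in\mathbb R$, operators $Y_{AB}$, $J_{\widetilde{\mathcal N}}$ on $A\otimes B$ and $V_B$ on $B$, $$\begin{aligned} \inf\quad & \gamma\\ \text{s.t.}\quad & \mathrm{tr}_B\,Y_{AB}\le\gamma\,\mathbb 1_A,\\ & Y_{AB}\ge J_{\widetilde{\mathcal N}}-J_{\mathcal N},\quad Y_{AB}\ge 0,\\ & J_{\widetilde{\mathcal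 N}}\ge 0,\quad \mathrm{tr}_B\,J_{\widetilde{\mathcal N}}=\mathbb 1_A,\\ & J_{\widetilde{\mathcal N}}\le\mathbb 1_A\otimes V_B,\quad \mathrm{tr}\,V_B=m^2 , \end{aligned}$$ and $\omega_{\mathrm{NS}\cap\mathrm{PPT}}(\mathrm{id}_m,\mathcal N)$ is finite and equals the optimal value of the same program with the additional constraint $$-\mathbb 1_A\otimes V_B^{T}\ \le\ m\,J_{\widetilde{\mathcal N}}^{T_B}\ \le\ \mathbb 1_A\otimes V_B^{T}.$$ In particular both programs are feasible. Here $\le$ is the Loewner order and $T_B$ is the partial transpose over $B$. -/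

import Mathlib

open scoped Kronecker MatrixOrder ENNReal

noncomputable section

namespace ChannelSim

/-- Linear maps from operators on `ℂ^α` to operators on `ℂ^β`. -/
abbrev SuperOp (α β : Type*) := Matrix α α ℂ →ₗ[ℂ] Matrix β β ℂ

section Matrices

variable {α β : Type*}

/-- Partial trace over the first tensor factor. -/
def traceLeft [Fintype α] (M : Matrix (α × β) (α × β) ℂ) : Matrix β β ℂ :=
  Matrix.of fun b b' => ∑ a, M (a, b) (a, b')

/-- Partial trace over the second tensor factor. -/
def traceRight [Fintype β] (M : Matrix (α × β) (α × β) ℂ) : Matrix α α ℂ :=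
  Matrix.of fun a a' => ∑ b, M (a, b) (a', b)

/-- Partial transpose over the second tensor factor. -/
def transposeRight (M : Matrix (α × β) (α × β) ℂ) : Matrix (α × β) (α × β) ℂ :=
  Matrix.of fun p q => M (p.1, q.2) (q.1, p.2)

/-- The Schatten 1-norm `‖X‖₁ = tr √(X† X)`. -/
def traceNorm [Fintype α] [DecidableEq α] (X : Matrix α α ℂ) : ℝ :=
  (cfc Real.sqrt (X.conjTranspose * X)).trace.re

/-- Density operators. -/
structure IsState [Fintype α] (ρ : Matrix α α ℂ) : Prop where
  nonneg : 0 ≤ ρ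
  trace_one : ρ.trace = 1

end Matrices

section Channels

variable {α β : Type*}

/-- The Choi-Jamiolkowski matrix `J_Φ = ∑ i j, |i⟩⟨j| ⊗ Φ(|i⟩⟨j|)`. -/
def choi [DecidableEq α] (Φ : SuperOp α β) : Matrix (α × β) (α × β) ℂ :=
  Matrix.of fun p q => Φ (Matrix.single p.1 q.1 1) p.2 q.2

/-- The map `Φ ⊗ id_κ`. -/
def ampliate (κ : Type*) (Φ : SuperOp α β) : SuperOp (α × κ) (β × κ) where
  toFun X := Matrix.of fun p q => Φ (Matrix.of fun a a' => X (a, p.2) (a', q.2)) p.1 q.1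
  map_add' X Y := by
    ext p q
    exact congrFun (congrFun (Φ.map_add (Matrix.of fun a a' => X (a, p.2) (a', q.2))
      (Matrix.of fun a a' => Y (a, p.2) (a', q.2))) p.1) q.1
  map_smul' c X := by
    ext p q
    exact congrFun (congrFun (Φ.map_smul c (Matrix.of fun a a' => X (a, p.2) (a', q.2))) p.1) q.1

/-- `ampliate κ Φ` is indeed `Φ ⊗ id_κ`. -/
theorem ampliate_kronecker (κ : Type*) (Φ : SuperOp α β) (X : Matrix α α ℂ) (Z : Matrix κ κ ℂ) :
    ampliate κ Φ (X ⊗ₖ Z) = Φ X ⊗ₖ Z := by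
  ext p q
  have h : (Matrix.of fun a a' => (X ⊗ₖ Z) (a, p.2) (a', q.2)) = Z p.2 q.2 • X := by
    ext a a'
    simp [mul_comm]
  change Φ (Matrix.of fun a a' => (X ⊗ₖ Z) (a, p.2) (a', q.2)) p.1 q.1 = _
  rw [h, map_smul]
  simp [mul_comm]

/-- Quantum channels: completely positive and trace preserving linear maps. -/
structure IsChannel [Fintype α] [Fintype β] (Φ : SuperOp α β) : Prop where
  completely_positive : ∀ (k : ℕ) (X : Matrix (α × Fin k) (α × Fin k) ℂ),
    0 ≤ X → 0 ≤ ampliate (Fin k) Φ X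
  trace_preserving : ∀ X : Matrix α α ℂ, (Φ X).trace = X.trace

/-- The diamond norm `sup_k sup_{‖X‖₁ ≤ 1} ‖(Φ ⊗ id_k)(X)‖₁`, as an extended nonnegative real. -/
def diamondNorm [Fintype α] [DecidableEq α] [Fintype β] [DecidableEq β] (Φ : SuperOp α β) :
    ℝ≥0∞ :=
  ⨆ (k : ℕ) (X : Matrix (α × Fin k) (α × Fin k) ℂ) (_ : traceNorm X ≤ 1),
    ENNReal.ofReal (traceNorm (ampliate (Fin k) Φ X))

end Channels

section Codes

variable {Ai Bi Ao Bo : Type*}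

/-- The effective map `Π ∘ N` from `Ai` to `Bo`, obtained by feeding the output `Ao` of the
bipartite map `Π` through `N` into its input `Bi`. It is the contraction
`(Π ∘ N)(X) = ∑ ⟨i| N(|o⟩⟨o'|) |i'⟩ • ⟨o| Π(X ⊗ |i⟩⟨i'|) |o'⟩`, that is, the extension, linear in
`Π`, of the rule `(E ⊗ D) ∘ N = D ∘ N ∘ E` for product maps. -/
def plug [Fintype Ao] [DecidableEq Ao] [Fintype Bi] [DecidableEq Bi]
    (P : SuperOp (Ai × Bi) (Ao × Bo)) (N : SuperOp Ao Bi) : SuperOp Ai Bo where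
  toFun X := Matrix.of fun b b' => ∑ o, ∑ o', ∑ i, ∑ i',
    N (Matrix.single o o' 1) i i' * P (X ⊗ₖ Matrix.single i i' 1) (o, b) (o', b')
  map_add' X Y := by
    ext b b'
    simp [Matrix.add_kronecker, mul_add, Finset.sum_add_distrib]
  map_smul' c X := by
    ext b b'
    simp [Matrix.smul_kronecker, Finset.mul_sum, mul_left_comm]

/-- For a bipartite map `Π` realised by an encoder `E : Ai → Ao ⊗ R` and a decoder
`D : R ⊗ Bi → Bo` sharing a memory `R`, the effective map is `D ∘ (N ⊗ id_R) ∘ E`. -/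
theorem plug_of_memory {R : Type*} [Fintype Ao] [DecidableEq Ao] [Fintype Bi] [DecidableEq Bi]
    (P : SuperOp (Ai × Bi) (Ao × Bo)) (N : SuperOp Ao Bi)
    (E : SuperOp Ai (Ao × R)) (D : SuperOp (Bi × R) Bo)
    (h : ∀ X Y o o' b b', P (X ⊗ₖ Y) (o, b) (o', b') =
      D (Matrix.of fun p q => E X (o, p.2) (o', q.2) * Y p.1 q.1) b b') :
    plug P N = D ∘ₗ ampliate R N ∘ₗ E := by
  refine LinearMap.ext fun X => ?_
  have key : ampliate R N (E X) = ∑ o, ∑ o', ∑ i, ∑ i', N (Matrix.single o o' 1) i i' •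
      (Matrix.of fun (p q : Bi × R) =>
        E X (o, p.2) (o', q.2) * Matrix.single i i' (1 : ℂ) p.1 q.1) := by
    ext p q
    have h1 : (Matrix.of fun o o' => E X (o, p.2) (o', q.2)) =
        ∑ o, ∑ o', E X (o, p.2) (o', q.2) • Matrix.single o o' (1 : ℂ) := by
      conv_lhs => rw [Matrix.matrix_eq_sum_single (Matrix.of fun o o' => E X (o, p.2) (o', q.2))]
      simp [Matrix.smul_single]
    simp only [ampliate, LinearMap.coe_mk, AddHom.coe_mk, Matrix.of_apply, h1, map_sum, map_smul,
      Matrix.sum_apply, Matrix.smul_apply, smul_eq_mul]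
    refine Finset.sum_congr rfl fun o _ => Finset.sum_congr rfl fun o' _ => ?_
    rw [Finset.sum_eq_single p.1, Finset.sum_eq_single q.1]
    · simp [mul_comm]
    · intro i' _ hi
      simp [hi]
    · simp
    · intro i _ hi
      simp [hi]
    · simp
  ext b b'
  simp only [LinearMap.comp_apply, key, map_sum, map_smul, Matrix.sum_apply, Matrix.smul_apply,
    smul_eq_mul, plug, LinearMap.coe_mk, AddHom.coe_mk, Matrix.of_apply, h]

variable [Fintype Ai] [Fintype Bi] [Fintype Ao] [Fintype Bo]

/-- `A` cannot signal to `B`: the output at `B` does not depend on the state input at `A`. -/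
def NoSignalAB (P : SuperOp (Ai × Bi) (Ao × Bo)) : Prop :=
  ∀ (ρ₁ ρ₂ : Matrix Ai Ai ℂ) (σ : Matrix Bi Bi ℂ), IsState ρ₁ → IsState ρ₂ →
    traceLeft (P (ρ₁ ⊗ₖ σ)) = traceLeft (P (ρ₂ ⊗ₖ σ))

/-- `B` cannot signal to `A`: the output at `A` does not depend on the state input at `B`. -/
def NoSignalBA (P : SuperOp (Ai × Bi) (Ao × Bo)) : Prop :=
  ∀ (ρ : Matrix Ai Ai ℂ) (σ₁ σ₂ : Matrix Bi Bi ℂ), IsState σ₁ → IsState σ₂ →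
    traceRight (P (ρ ⊗ₖ σ₁)) = traceRight (P (ρ ⊗ₖ σ₂))

variable (Ai Bi Ao Bo) in
/-- No-signalling assisted codes: bipartite channels that are no-signalling both ways. -/
def NSCodes : Set (SuperOp (Ai × Bi) (Ao × Bo)) :=
  {P | IsChannel P ∧ NoSignalAB P ∧ NoSignalBA P}

variable (Ai Bi Ao Bo) in
/-- PPT-assisted codes: bipartite channels, no-signalling from `B` to `A`, whose
Choi-Jamiolkowski matrix is positive under partial transpose over `Bi` and `Bo`. -/
def PPTCodes [DecidableEq Ai] [DecidableEq Bi] : Set (SuperOp (Ai × Bi) (Ao × Bo)) :=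
  {P | IsChannel P ∧ NoSignalBA P ∧
    0 ≤ (Matrix.of fun p q : (Ai × Bi) × (Ao × Bo) =>
      choi P ((p.1.1, q.1.2), (p.2.1, q.2.2)) ((q.1.1, p.1.2), (q.2.1, p.2.2)))}

/-- The minimum error `(1/2) inf_{Π ∈ Ω} ‖Π ∘ N - M‖_⋄` of simulating `M` from `N` with codes
in `Ω`. -/
def simError [DecidableEq Ai] [DecidableEq Bi] [DecidableEq Ao] [DecidableEq Bo]
    (Ω : Set (SuperOp (Ai × Bi) (Ao × Bo))) (N : SuperOp Ao Bi) (M : SuperOp Ai Bo) : ℝ≥0∞ :=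
  2⁻¹ * ⨅ P ∈ Ω, diamondNorm (plug P N - M)

end Codes

/-- The noiseless channel on `ℂ^m`. -/
def idChannel (m : ℕ) : SuperOp (Fin m) (Fin m) := LinearMap.id

/-- The minimum error of simulating `N` from the `m`-dimensional noiseless channel with
no-signalling assisted codes. -/
def omegaNS {A B : Type*} [Fintype A] [DecidableEq A] [Fintype B] [DecidableEq B]
    (m : ℕ) (N : SuperOp A B) : ℝ≥0∞ :=
  simError (NSCodes A (Fin m) (Fin m) B) (idChannel m) N

/-- The minimum error of simulating `N` from the `m`-dimensional noiseless channel with codes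
that are both no-signalling and PPT-assisted. -/
def omegaNSPPT {A B : Type*} [Fintype A] [DecidableEq A] [Fintype B] [DecidableEq B]
    (m : ℕ) (N : SuperOp A B) : ℝ≥0∞ :=
  simError (NSCodes A (Fin m) (Fin m) B ∩ PPTCodes A (Fin m) (Fin m) B) (idChannel m) N

end ChannelSim

end

open scoped ComplexOrder

noncomputable section

namespace ChannelSim

open Matrix

attribute [local instance 2000] RCLike.toPartialOrder

/-! Two independent facts combine.

(1) If $F$ is a difference of channels with Choi matrix $J_F$, then $\frac12\|F\|_\diamondsuit$ is
the infimum of the $\gamma$ for which some $Y\ge 0$, $Y\ge J_F$ has $\mathrm{tr}_B Y\le\gamma 1$.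
For the upper bound (`diamondNorm_le_of_le`), $F$ is the difference of the completely positive maps
with Choi matrices $Y$ and $Y-J_F$, which act on positive block matrices containing $\pm X$. For the
lower bound (`exists_dual_point`), purifying a faithful state and taking the positive part of the
output gives a $Y$ good at that state; Sion's theorem makes one $Y$ good at all states.

(2) The Choi matrices of the maps $\Pi\circ\mathrm{id}_m$ are exactly the $\tilde J$ allowed by the
program. Let $Q$ be the unnormalised maximally entangled operator on $B_iA_o$. Then $\tilde J$ is
the contraction of $J_\Pi$ with $Q$, and $Q\le m1$ gives $\tilde J\le 1\otimes V$. The partial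
transpose of $Q$ is the flip, which lies between $-1$ and $1$; this gives the PPT constraint.
Conversely, `codeChoi` is a combination of $Q\otimes\tilde J$ and $(m1-Q)\otimes(1\otimes V-\tilde
J)$ and realises any feasible $(\tilde J,V)$.

`isGLB_simError` joins the two for an abstract constraint, so both programs are instances. -/

theorem _root_.Matrix.PosSemidef.trace_mul_nonneg {ι : Type*} [Fintype ι] {P Q : Matrix ι ι ℂ}
    (hP : P.PosSemidef) (hQ : Q.PosSemidef) : 0 ≤ (P * Q).trace := by
  classical
  obtain ⟨B, rfl⟩ := CStarAlgebra.nonneg_iff_eq_star_mul_self.mp hQ.nonneg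
  rw [star_eq_conjTranspose, ← Matrix.mul_assoc, trace_mul_comm, ← Matrix.mul_assoc]
  exact (hP.mul_mul_conjTranspose_same B).trace_nonneg

/-! ### Trace norm: polar decomposition and block matrices -/

section TraceNorm

variable {ι : Type*} [Fintype ι] [DecidableEq ι]

/-- A polar decomposition `X = W |X|`, with `W` a partial isometry. -/
theorem exists_polar (X : Matrix ι ι ℂ) :
    ∃ W S : Matrix ι ι ℂ, S = cfc Real.sqrt (Xᴴ * X) ∧ S.PosSemidef ∧ Wᴴ * X = S ∧ W * S = X ∧
      (1 - W * Wᴴ).PosSemidef := by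
  set H := Xᴴ * X with hH
  have hpsd : H.PosSemidef := posSemidef_conjTranspose_mul_self X
  have hsa : IsSelfAdjoint H := hpsd.isHermitian
  have hnn : ∀ x ∈ spectrum ℝ H, 0 ≤ x := fun x hx => spectrum_nonneg_of_nonneg hpsd.nonneg hx
  have hc : ∀ f : ℝ → ℝ, ContinuousOn f (spectrum ℝ H) := fun f =>
    (Matrix.finite_real_spectrum (A := H)).continuousOn f
  have hmul : ∀ f g : ℝ → ℝ, cfc f H * cfc g H = cfc (fun x => f x * g x) H := fun f g =>
    (cfc_mul f g H (hc f) (hc g)).symm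
  have hHid : cfc (fun x : ℝ => x) H = H := cfc_id' ℝ H
  -- With the convention $0^{-1}=0$, `R` is the pseudo-inverse of $|X|$ and `E` the projection onto
  -- its support, so $W=XR$ needs no invertibility.
  set R := cfc (fun x => (Real.sqrt x)⁻¹) H with hR
  set S := cfc Real.sqrt H with hS
  set E := cfc (fun x => (Real.sqrt x)⁻¹ * Real.sqrt x) H with hE
  have hRsa : Rᴴ = R := (cfc_predicate (fun x => (Real.sqrt x)⁻¹) H : IsSelfAdjoint R)
  have hEsa : Eᴴ = E := (cfc_predicate _ H : IsSelfAdjoint E)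
  have hRS : R * S = E := hmul _ _
  have hRH : R * H = S := by
    conv_lhs => rw [← hHid, hR, hmul]
    refine cfc_congr fun x hx => ?_
    rw [mul_comm, ← div_eq_mul_inv, Real.div_sqrt]
  have hEH : E * H = H := by
    conv_lhs => rw [← hHid, hE, hmul]
    conv_rhs => rw [← hHid]
    refine cfc_congr fun x hx => ?_
    rcases (hnn x hx).eq_or_lt with h | h
    · simp [← h]
    · have := (Real.sqrt_pos.2 h).ne'
      field_simp
  have hER : E * R = R := by
    rw [hE, hR, hmul]
    refine cfc_congr fun x hx => ?_
    rcases (hnn x hx).eq_or_lt with h | h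
    · simp [← h]
    · have := (Real.sqrt_pos.2 h).ne'
      field_simp
  have hSR : S * R = E := by
    rw [hE, hR, hS, hmul]
    simp only [mul_comm]
  have hXE : X * E = X := by
    have h0 : (X - X * E)ᴴ * (X - X * E) = 0 := by
      have : (X - X * E)ᴴ * (X - X * E) = (H - E * H) - (H - E * H) * E := by
        rw [conjTranspose_sub, conjTranspose_mul, hEsa, hH]
        noncomm_ring
      rw [this, hEH]
      simp
    exact (sub_eq_zero.1 (conjTranspose_mul_self_eq_zero.1 h0)).symm
  refine ⟨X * R, S, rfl, ?_, ?_, ?_, ?_⟩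
  · exact nonneg_iff_posSemidef.1 (cfc_nonneg fun x _ => Real.sqrt_nonneg x)
  · rw [conjTranspose_mul, hRsa, Matrix.mul_assoc, ← hH, hRH]
  · rw [Matrix.mul_assoc, hRS, hXE]
  -- $WW^*$ is a Hermitian idempotent, hence so is $1-WW^*$, which therefore has the form $M^*M$.
  · have hid : (X * R * (X * R)ᴴ) * (X * R * (X * R)ᴴ) = X * R * (X * R)ᴴ := by
      rw [conjTranspose_mul, hRsa]
      have : X * R * (R * Xᴴ) * (X * R * (R * Xᴴ)) = X * (R * (R * H * R) * R) * Xᴴ := by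
        rw [hH]; noncomm_ring
      rw [this, hRH, hSR, Matrix.mul_assoc R E R, hER]
      noncomm_ring
    have hs : (1 - X * R * (X * R)ᴴ)ᴴ = 1 - X * R * (X * R)ᴴ := by simp
    have : 1 - X * R * (X * R)ᴴ = (1 - X * R * (X * R)ᴴ)ᴴ * (1 - X * R * (X * R)ᴴ) := by
      rw [hs, mul_sub, sub_mul, sub_mul, hid]
      simp
    rw [this]
    exact posSemidef_conjTranspose_mul_self _

/-- `X` and the moduli of `Xᴴ` and `X` form a positive block matrix. -/
theorem exists_fromBlocks_posSemidef (X : Matrix ι ι ℂ) :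
    ∃ P Q : Matrix ι ι ℂ, (fromBlocks P X Xᴴ Q).PosSemidef ∧
      P.trace.re = traceNorm X ∧ Q.trace.re = traceNorm X := by
  obtain ⟨W, S, hS, hpos, hWX, hWS, -⟩ := exists_polar X
  have hSX : S * Wᴴ = Xᴴ := by rw [← hWS, conjTranspose_mul, hpos.isHermitian.eq]
  refine ⟨W * S * Wᴴ, S, ?_, ?_, by rw [hS]; rfl⟩
  · have h := hpos.mul_mul_conjTranspose_same (fromRows W (1 : Matrix ι ι ℂ))
    rw [conjTranspose_fromRows_eq_fromCols_conjTranspose, fromRows_mul, fromRows_mul_fromCols] at h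
    simpa [hWS, hSX] using h
  · rw [trace_mul_comm, hWS, hWX, hS]
    rfl

/-- Compressing the block matrix by the column $(W,-1)$, with $X=W|X|$, gives $W^*PW-2|X|+Q\ge 0$.
Taking traces and using $WW^*\le 1$ gives the bound. -/
theorem traceNorm_le_of_fromBlocks {X P Q : Matrix ι ι ℂ}
    (h : (fromBlocks P X Xᴴ Q).PosSemidef) :
    traceNorm X ≤ (P.trace.re + Q.trace.re) / 2 := by
  obtain ⟨W, S, hS, hpos, hWX, hWS, hW⟩ := exists_polar X
  have hSX : Xᴴ * W = S := by
    rw [← hpos.isHermitian.eq, ← hWX, conjTranspose_mul, conjTranspose_conjTranspose]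
  have hP : P.PosSemidef := h.submatrix Sum.inl
  have h1 := h.conjTranspose_mul_mul_same (fromRows W (-1 : Matrix ι ι ℂ))
  rw [conjTranspose_fromRows_eq_fromCols_conjTranspose, fromCols_mul_fromBlocks,
    fromCols_mul_fromRows] at h1
  have h2 := hP.trace_mul_nonneg hW
  have h3 := (Complex.le_def.1 h1.trace_nonneg).1
  have h4 := (Complex.le_def.1 h2).1
  have h5 : (Wᴴ * P * W).trace = (P * (W * Wᴴ)).trace := by
    rw [Matrix.mul_assoc, trace_mul_comm, Matrix.mul_assoc]
  have h6 : traceNorm X = S.trace.re := by rw [hS]; rfl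
  simp only [conjTranspose_neg, conjTranspose_one, Matrix.mul_neg, Matrix.neg_mul, Matrix.mul_one,
    Matrix.one_mul, Matrix.add_mul, hWX, hSX, trace_add, trace_neg, h5, Matrix.mul_sub, trace_sub,
    Complex.add_re, Complex.neg_re, Complex.sub_re, Complex.zero_re] at h3 h4
  rw [h6]
  linarith

theorem traceNorm_le_of_posSemidef {X : Matrix ι ι ℂ} (h : X.PosSemidef) :
    traceNorm X ≤ X.trace.re := by
  have h1 : (fromBlocks X X Xᴴ X).PosSemidef := by
    rw [h.isHermitian.eq]
    convert h.submatrix (Sum.elim id id : ι ⊕ ι → ι)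
    ext (i | i) (j | j) <;> rfl
  simpa using traceNorm_le_of_fromBlocks h1

/-- A Hermitian matrix of trace zero is dominated by a positive matrix whose trace is half its
trace norm. -/
theorem exists_posSemidef_ge_of_trace_eq_zero {Z : Matrix ι ι ℂ} (hZ : Z.IsHermitian)
    (h0 : Z.trace = 0) :
    ∃ P : Matrix ι ι ℂ, P.PosSemidef ∧ (P - Z).PosSemidef ∧ P.trace.re = traceNorm Z / 2 := by
  have hsa : IsSelfAdjoint Z := hZ
  have hc : ∀ f : ℝ → ℝ, ContinuousOn f (spectrum ℝ Z) := fun f =>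
    (Matrix.finite_real_spectrum (A := Z)).continuousOn f
  have habs : cfc Real.sqrt (Zᴴ * Z) = cfc (fun x : ℝ => |x|) Z := by
    rw [hZ.eq]
    have h1 : Z * Z = cfc (fun x : ℝ => x * x) Z := by
      rw [cfc_mul _ _ Z, cfc_id' ℝ Z]
    rw [h1, ← cfc_comp' Real.sqrt (fun x : ℝ => x * x) Z]
    exact cfc_congr fun x _ => Real.sqrt_mul_self_eq_abs x
  have hid : cfc (fun x : ℝ => x) Z = Z := cfc_id' ℝ Z
  have h1 : (2 : ℝ)⁻¹ • (cfc (fun x : ℝ => |x|) Z + Z) = cfc (fun x : ℝ => 2⁻¹ * (|x| + x)) Z := by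
    have h3 : cfc (fun x : ℝ => 2⁻¹ * (|x| + x)) Z =
        (2 : ℝ)⁻¹ • cfc (fun x : ℝ => |x| + x) Z := cfc_smul (2⁻¹ : ℝ) _ Z (hc _)
    rw [h3, cfc_add Z _ _ (hc _) (hc _), hid]
  have h2 : (2 : ℝ)⁻¹ • (cfc (fun x : ℝ => |x|) Z + Z) - Z =
      cfc (fun x : ℝ => 2⁻¹ * (|x| + x) - x) Z := by
    rw [cfc_sub _ _ Z (hc _) (hc _), hid, h1]
  -- The positive part of $Z$; its trace is $\frac12\mathrm{tr}|Z|$ because $\mathrm{tr}\,Z=0$.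
  refine ⟨(2 : ℝ)⁻¹ • (cfc (fun x : ℝ => |x|) Z + Z), ?_, ?_, ?_⟩
  · rw [h1]
    exact nonneg_iff_posSemidef.1 (cfc_nonneg fun x _ => by linarith [neg_abs_le x])
  · rw [h2]
    exact nonneg_iff_posSemidef.1 (cfc_nonneg fun x _ => by linarith [le_abs_self x])
  · rw [traceNorm, habs, trace_smul, trace_add, h0]
    simp
    ring

end TraceNorm

/-! ### Contractions of positive matrices -/

section Contraction

theorem _root_.Matrix.PosSemidef.of_apply_eq {ι : Type*} {M N : Matrix ι ι ℂ} (hN : N.PosSemidef)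
    (h : ∀ i j, M i j = N i j) : M.PosSemidef :=
  (Matrix.ext h : M = N) ▸ hN

theorem posSemidef_sum_right {α β : Type*} [Fintype α] [Fintype β]
    {M : Matrix (α × β) (α × β) ℂ} (hM : M.PosSemidef) :
    (of fun x x' => ∑ y, ∑ y', M (x, y) (x', y') : Matrix α α ℂ).PosSemidef := by
  classical
  have h := hM.conjTranspose_mul_mul_same
    (of fun p x => if p.1 = x then 1 else 0 : Matrix (α × β) α ℂ)
  convert h using 1
  ext x x'
  simp only [of_apply, Matrix.mul_apply, conjTranspose_apply, Fintype.sum_prod_type, apply_ite star,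
    star_one, star_zero, ite_mul, one_mul, zero_mul, mul_ite, mul_one, mul_zero]
  conv_rhs => rw [Finset.sum_comm]
  conv_rhs =>
    enter [2, y']
    rw [Finset.sum_ite_eq' Finset.univ x', if_pos (Finset.mem_univ _), Finset.sum_comm]
    enter [2, y]
    rw [Finset.sum_ite_eq' Finset.univ x, if_pos (Finset.mem_univ _)]
  exact Finset.sum_comm

/-- Contracting two positive matrices along a common index gives a positive matrix. -/
theorem posSemidef_contract {α β κ ι : Type*} [Fintype α] [Fintype β]
    {D : Matrix κ κ ℂ} {J : Matrix ι ι ℂ} (hD : D.PosSemidef) (hJ : J.PosSemidef)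
    (g : α → β → κ) (f : α → β → ι) :
    (of fun x x' => ∑ y, ∑ y', D (g x y) (g x' y') * J (f x y) (f x' y') :
      Matrix α α ℂ).PosSemidef := by
  -- The Schur product theorem; pulling back along arbitrary `g` and `f` lets indices be repeated or
  -- dropped.
  have h := (hD.submatrix fun p : α × β => g p.1 p.2).hadamard
    (hJ.submatrix fun p : α × β => f p.1 p.2)
  have h2 := posSemidef_sum_right h
  exact h2

end Contraction

/-! ### Choi matrices and channels -/

section Choi

variable {α β κ : Type*}

/-- The linear map with a given Choi matrix. -/
def ofChoi [Fintype α] (J : Matrix (α × β) (α × β) ℂ) : SuperOp α β where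
  toFun X := of fun b b' => ∑ a, ∑ a', X a a' * J (a, b) (a', b')
  map_add' X Y := by
    ext b b'
    simp [add_mul, Finset.sum_add_distrib]
  map_smul' c X := by
    ext b b'
    simp [Finset.mul_sum, mul_assoc]

theorem choi_ofChoi [Fintype α] [DecidableEq α] (J : Matrix (α × β) (α × β) ℂ) :
    choi (ofChoi J) = J := by
  ext ⟨a, b⟩ ⟨a', b'⟩
  simp only [choi, ofChoi, LinearMap.coe_mk, AddHom.coe_mk, of_apply, Matrix.single_apply]
  rw [Finset.sum_eq_single a, Finset.sum_eq_single a']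
  · simp
  · intro c _ hc
    simp [hc.symm]
  · simp
  · intro c _ hc
    simp [hc.symm]
  · simp

theorem ofChoi_choi [Fintype α] [DecidableEq α] (Φ : SuperOp α β) : ofChoi (choi Φ) = Φ := by
  refine LinearMap.ext fun X => ?_
  ext b b'
  conv_rhs => rw [matrix_eq_sum_single X]
  simp only [choi, ofChoi, LinearMap.coe_mk, AddHom.coe_mk, of_apply, map_sum, Matrix.sum_apply]
  refine Finset.sum_congr rfl fun a _ => Finset.sum_congr rfl fun a' _ => ?_
  rw [← mul_one (X a a'), ← smul_eq_mul (X a a'), ← smul_single, map_smul]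
  simp

theorem choi_sub [DecidableEq α] (Φ Ψ : SuperOp α β) : choi (Φ - Ψ) = choi Φ - choi Ψ := rfl

theorem ampliate_ofChoi_apply [Fintype α] (J : Matrix (α × β) (α × β) ℂ)
    (X : Matrix (α × κ) (α × κ) ℂ) (p q : β × κ) : ampliate κ (ofChoi J) X p q =
      ∑ a, ∑ a', X (a, p.2) (a', q.2) * J (a, p.1) (a', q.1) := rfl

variable [Fintype α] [Fintype β] [Fintype κ]

theorem posSemidef_ampliate_ofChoi {J : Matrix (α × β) (α × β) ℂ} (hJ : J.PosSemidef)
    {X : Matrix (α × κ) (α × κ) ℂ} (hX : X.PosSemidef) :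
    (ampliate κ (ofChoi J) X).PosSemidef :=
  posSemidef_contract hX hJ (fun (p : β × κ) a => (a, p.2)) fun p a => (a, p.1)

theorem trace_ofChoi (J : Matrix (α × β) (α × β) ℂ) (X : Matrix α α ℂ) :
    (ofChoi J X).trace = ∑ a, ∑ a', X a a' * traceRight J a a' := by
  simp only [Matrix.trace, diag_apply, ofChoi, LinearMap.coe_mk, AddHom.coe_mk, of_apply,
    traceRight, Finset.mul_sum]
  rw [Finset.sum_comm]
  exact Finset.sum_congr rfl fun a _ => Finset.sum_comm

theorem isChannel_ofChoi [DecidableEq α] {J : Matrix (α × β) (α × β) ℂ} (hJ : J.PosSemidef)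
    (h1 : traceRight J = 1) : IsChannel (ofChoi J) where
  completely_positive k X hX :=
    (posSemidef_ampliate_ofChoi hJ (nonneg_iff_posSemidef.1 hX)).nonneg
  trace_preserving X := by
    rw [trace_ofChoi, h1]
    simp [Matrix.one_apply, Matrix.trace]

/-- The Choi matrix is the image of the maximally entangled projector. Complete positivity is stated
for reference systems `Fin k`, so the second copy of `α` is transported along `e`. -/
theorem IsChannel.posSemidef_choi [DecidableEq α] {Φ : SuperOp α β} (h : IsChannel Φ) :
    (choi Φ).PosSemidef := by
  let e := Fintype.equivFin α
  let v : α × Fin (Fintype.card α) → ℂ := fun p => if e p.1 = p.2 then 1 else 0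
  have hX := h.completely_positive _ (vecMulVec v (star v))
    (posSemidef_vecMulVec_self_star v).nonneg
  suffices key : choi Φ = (ampliate (Fin (Fintype.card α)) Φ (vecMulVec v (star v))).submatrix
      (fun p : α × β => (p.2, e p.1)) (fun p : α × β => (p.2, e p.1)) by
    rw [key]
    exact (nonneg_iff_posSemidef.1 hX).submatrix _
  ext ⟨a, b⟩ ⟨a', b'⟩
  have : (of fun c c' : α => vecMulVec v (star v) (c, e a) (c', e a') : Matrix α α ℂ) =
      single a a' (1 : ℂ) := by
    ext c c'
    by_cases h1 : a = c <;> by_cases h2 : a' = c' <;>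
      simp [v, vecMulVec_apply, h1, h2, eq_comm (a := c), eq_comm (a := c')]
  change Φ (single a a' 1) b b' =
    Φ (of fun c c' : α => vecMulVec v (star v) (c, e a) (c', e a')) b b'
  rw [this]

theorem IsChannel.traceRight_choi [DecidableEq α] {Φ : SuperOp α β} (h : IsChannel Φ) :
    traceRight (choi Φ) = 1 := by
  ext a a'
  change (Φ (single a a' 1)).trace = _
  rw [h.trace_preserving]
  by_cases h1 : a = a'
  · subst h1
    simp
  · simp [h1, Matrix.trace_single_eq_of_ne]

end Choi

/-! ### Diamond norm: upper bound from a dual point -/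

section WeakDuality

variable {α β κ : Type*} [Fintype α] [Fintype β] [Fintype κ]

/-- Ampliations of completely positive maps act blockwise. -/
theorem posSemidef_fromBlocks_ampliate {J : Matrix (α × β) (α × β) ℂ} (hJ : J.PosSemidef)
    {P X Y Q : Matrix (α × κ) (α × κ) ℂ} (h : (fromBlocks P X Y Q).PosSemidef) :
    (fromBlocks (ampliate κ (ofChoi J) P) (ampliate κ (ofChoi J) X) (ampliate κ (ofChoi J) Y)
      (ampliate κ (ofChoi J) Q)).PosSemidef := by
  convert posSemidef_contract h hJ
    (Sum.elim (fun p a => Sum.inl (a, p.2)) (fun p a => Sum.inr (a, p.2)) :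
      (β × κ) ⊕ (β × κ) → α → (α × κ) ⊕ (α × κ))
    (Sum.elim (fun p a => (a, p.1)) (fun p a => (a, p.1)))
  ext (i | i) (j | j) <;> rfl

theorem trace_ampliate_ofChoi (J : Matrix (α × β) (α × β) ℂ) (P : Matrix (α × κ) (α × κ) ℂ) :
    (ampliate κ (ofChoi J) P).trace = ∑ k, ∑ a, ∑ a', P (a, k) (a', k) * traceRight J a a' := by
  simp only [Matrix.trace, diag_apply, Fintype.sum_prod_type]
  rw [Finset.sum_comm]
  exact Finset.sum_congr rfl fun k _ => trace_ofChoi J (of fun a a' => P (a, k) (a', k))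

/-- The difference of the two sides is the trace of a contraction of the positive matrices $P$ and
$\gamma 1-\mathrm{tr}_B J$. -/
theorem re_trace_ampliate_ofChoi_le [DecidableEq α] {J : Matrix (α × β) (α × β) ℂ} {γ : ℝ}
    (hγ : ((γ : ℂ) • 1 - traceRight J).PosSemidef) {P : Matrix (α × κ) (α × κ) ℂ}
    (hP : P.PosSemidef) : (ampliate κ (ofChoi J) P).trace.re ≤ γ * P.trace.re := by
  have h := (posSemidef_contract hP hγ (fun (k : κ) a => (a, k)) fun _ a => a).trace_nonneg
  have h3 : P.trace = ∑ k, ∑ a, P (a, k) (a, k) := by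
    simp only [Matrix.trace, diag_apply, Fintype.sum_prod_type]
    rw [Finset.sum_comm]
  have h4 : (γ : ℂ) * P.trace - (ampliate κ (ofChoi J) P).trace =
      (of fun k k' => ∑ a, ∑ a', P (a, k) (a', k') * ((γ : ℂ) • 1 - traceRight J) a a' :
        Matrix κ κ ℂ).trace := by
    rw [trace_ampliate_ofChoi, h3]
    simp only [Matrix.trace, diag_apply, of_apply, Matrix.sub_apply, Matrix.smul_apply,
      Matrix.one_apply, mul_sub, Finset.sum_sub_distrib, Finset.mul_sum]
    congr 1
    simp [mul_comm]
  rw [← h4] at h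
  have := (Complex.le_def.1 h).1
  simp only [Complex.zero_re, Complex.sub_re, Complex.re_ofReal_mul] at this
  linarith

/-- Apply the map of $Y$ to a positive block matrix with corner $X$ and the map of $Y-J_F$ to the
same one with corner $-X$. The sum has corner $(F\otimes\mathrm{id})(X)$, and each of its diagonal
blocks has trace at most $2\gamma\|X\|_1$, because $Y$ and $Y-J_F$ have equal partial traces. -/
theorem diamondNorm_le_of_le [DecidableEq α] [DecidableEq β] {F : SuperOp α β}
    {Y : Matrix (α × β) (α × β) ℂ} {γ : ℝ}
    (hF : traceRight (choi F) = 0) (hγ : ((γ : ℂ) • 1 - traceRight Y).PosSemidef)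
    (hY : Y.PosSemidef) (hFY : (Y - choi F).PosSemidef) (hγ0 : 0 ≤ γ) :
    diamondNorm F ≤ ENNReal.ofReal (2 * γ) := by
  refine iSup_le fun k => iSup_le fun X => iSup_le fun hX => ENNReal.ofReal_le_ofReal ?_
  obtain ⟨P, Q, hPQ, hP, hQ⟩ := exists_fromBlocks_posSemidef X
  have hγ' : ((γ : ℂ) • 1 - traceRight (Y - choi F)).PosSemidef := by
    have : traceRight (Y - choi F) = traceRight Y - traceRight (choi F) := by
      ext; simp [traceRight]
    rwa [this, hF, sub_zero]
  have hneg : (fromBlocks P (-X) (-Xᴴ) Q).PosSemidef := by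
    have := hPQ.conjTranspose_mul_mul_same
      (fromBlocks 1 0 0 (-1) : Matrix ((α × Fin k) ⊕ (α × Fin k)) ((α × Fin k) ⊕ (α × Fin k)) ℂ)
    simpa [fromBlocks_conjTranspose, fromBlocks_multiply] using this
  have hPp : P.PosSemidef := hPQ.submatrix Sum.inl
  have hQp : Q.PosSemidef := hPQ.submatrix Sum.inr
  have hb := (posSemidef_fromBlocks_ampliate hY hPQ).add (posSemidef_fromBlocks_ampliate hFY hneg)
  rw [fromBlocks_add] at hb
  have hsplit : ∀ Z : Matrix (α × Fin k) (α × Fin k) ℂ, ampliate (Fin k) (ofChoi Y) Z +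
      ampliate (Fin k) (ofChoi (Y - choi F)) (-Z) = ampliate (Fin k) F Z := by
    intro Z
    conv_rhs => rw [← ofChoi_choi F]
    ext p q
    simp only [Matrix.add_apply, ampliate_ofChoi_apply, ← Finset.sum_add_distrib]
    refine Finset.sum_congr rfl fun a _ => Finset.sum_congr rfl fun a' _ => ?_
    simp only [Matrix.neg_apply, Matrix.sub_apply]
    ring
  rw [hsplit, hsplit] at hb
  -- Read off from the Hermiticity of the positive block matrix.
  have hstar : ampliate (Fin k) F Xᴴ = (ampliate (Fin k) F X)ᴴ := by
    have := congrArg toBlocks₂₁ hb.isHermitian.eq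
    rw [fromBlocks_conjTranspose, toBlocks_fromBlocks₂₁, toBlocks_fromBlocks₂₁] at this
    exact this.symm
  rw [hstar] at hb
  refine (traceNorm_le_of_fromBlocks hb).trans ?_
  have i1 := re_trace_ampliate_ofChoi_le hγ hPp
  have i2 := re_trace_ampliate_ofChoi_le hγ hQp
  have i3 := re_trace_ampliate_ofChoi_le hγ' hPp
  have i4 := re_trace_ampliate_ofChoi_le hγ' hQp
  rw [hP] at i1 i3
  rw [hQ] at i2 i4
  simp only [trace_add, Complex.add_re]
  have := mul_le_mul_of_nonneg_left hX hγ0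
  linarith

end WeakDuality

/-! ### Diamond norm: dual points for faithful states -/

section StrongDuality

variable {α β : Type*} [Fintype α] [Fintype β]

theorem trace_mul_traceRight [DecidableEq β] (ρ : Matrix α α ℂ) (Y : Matrix (α × β) (α × β) ℂ) :
    (ρ * traceRight Y).trace = ((ρ ⊗ₖ (1 : Matrix β β ℂ)) * Y).trace := by
  simp only [Matrix.trace, diag_apply, Matrix.mul_apply, traceRight, of_apply,
    Fintype.sum_prod_type, kroneckerMap_apply, Matrix.one_apply, mul_ite, mul_one, mul_zero,
    ite_mul, zero_mul, Finset.mul_sum]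
  refine Finset.sum_congr rfl fun a _ => ?_
  rw [Finset.sum_comm]
  simp

variable [DecidableEq α] [DecidableEq β]

/-- For every faithful input state there is a dual point whose value at this state is at most half
the diamond norm. -/
theorem exists_dual_point_of_posDef {F : SuperOp α β} {d : ℝ} (hd : 0 ≤ d)
    (hF : diamondNorm F ≤ ENNReal.ofReal d) (hJ : (choi F).IsHermitian)
    (hJ0 : traceRight (choi F) = 0) {ρ : Matrix α α ℂ} (hρ : ρ.PosDef) (hρ1 : ρ.trace = 1) :
    ∃ Y : Matrix (α × β) (α × β) ℂ, Y.PosSemidef ∧ (Y - choi F).PosSemidef ∧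
      (ρ * traceRight Y).trace.re ≤ d / 2 := by
  obtain ⟨T, hT⟩ := CStarAlgebra.nonneg_iff_eq_star_mul_self.mp hρ.posSemidef.nonneg
  rw [star_eq_conjTranspose] at hT
  have hu : IsUnit T.det := by
    have h := (isUnit_iff_isUnit_det _).1 hρ.isUnit
    rw [hT, det_mul] at h
    exact isUnit_of_mul_isUnit_right h
  let e := Fintype.equivFin α
  -- A purification of $\rho=T^*T$, so $X=vv^*$ has trace norm at most $1$.
  let v : α × Fin (Fintype.card α) → ℂ := fun p => T (e.symm p.2) p.1
  let X := vecMulVec v (star v)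
  have hX1 : traceNorm X ≤ 1 := by
    refine (traceNorm_le_of_posSemidef (posSemidef_vecMulVec_self_star v)).trans_eq ?_
    rw [← Complex.one_re, ← hρ1, hT]
    congr 1
    simp only [Matrix.trace, diag_apply, vecMulVec_apply, Fintype.sum_prod_type, Matrix.mul_apply,
      v, Pi.star_apply, conjTranspose_apply]
    refine Finset.sum_congr rfl fun a _ => ?_
    rw [← e.sum_comp]
    simp [mul_comm]
  set K : Matrix (α × β) (α × β) ℂ := Tᴴ ⊗ₖ 1 with hK
  set Ki : Matrix (α × β) (α × β) ℂ := (Tᴴ)⁻¹ ⊗ₖ 1 with hKi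
  have hTu : IsUnit (Tᴴ).det := by rw [det_conjTranspose]; exact hu.star
  have hKKi : K * Ki = 1 := by
    rw [hK, hKi, ← mul_kronecker_mul, mul_nonsing_inv _ hTu, one_mul, one_kronecker_one]
  have hKiK : Ki * K = 1 := mul_eq_one_comm.1 hKKi
  set Z := ampliate (Fin (Fintype.card α)) F X with hZ
  let f : α × β ≃ β × Fin (Fintype.card α) := (Equiv.prodComm α β).trans
    ((Equiv.refl β).prodCongr e)
  -- Up to reordering the tensor factors, the output on the purification is the Choi matrix
  -- conjugated by $K=T^*\otimes 1$.
  have hZK : Z.submatrix f f = Kᴴ * choi F * K := by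
    ext ⟨c, b⟩ ⟨c', b'⟩
    have : Z (f (c, b)) (f (c', b')) =
        ∑ a, ∑ a', X (a, e c) (a', e c') * choi F (a, b) (a', b') := by
      rw [hZ, ← ofChoi_choi F, ampliate_ofChoi_apply, ofChoi_choi]
      rfl
    rw [submatrix_apply, this]
    simp only [Matrix.mul_apply, Fintype.sum_prod_type, hK, conjTranspose_apply,
      kroneckerMap_apply, Matrix.one_apply, star_star, apply_ite star,
      star_zero, mul_ite, mul_one, mul_zero, ite_mul, zero_mul, Finset.sum_ite_eq', Finset.mem_univ,
      if_true, Finset.sum_mul]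
    rw [Finset.sum_comm]
    refine Finset.sum_congr rfl fun a' _ => Finset.sum_congr rfl fun a _ => ?_
    simp [X, v, vecMulVec_apply]
    ring
  have hZherm : Z.IsHermitian := by
    have h1 : (Z.submatrix f f).IsHermitian := by
      rw [hZK]
      exact isHermitian_conjTranspose_mul_mul K hJ
    have h2 := h1.submatrix f.symm
    simpa using h2
  have hZ0 : Z.trace = 0 := by
    rw [hZ, ← ofChoi_choi F, trace_ampliate_ofChoi, hJ0]
    simp
  have hZd : traceNorm Z ≤ d := by
    rw [← ENNReal.ofReal_le_ofReal_iff hd]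
    refine le_trans ?_ hF
    exact le_iSup_of_le _ (le_iSup_of_le X (le_iSup_of_le hX1 le_rfl))
  obtain ⟨P, hP, hPZ, hPt⟩ := exists_posSemidef_ge_of_trace_eq_zero hZherm hZ0
  -- Undoing the conjugation turns $P\ge Z$ into $Y\ge J_F$; since $KK^*=\rho\otimes 1$, the value
  -- of $Y$ at $\rho$ is $\mathrm{tr}\,P$.
  refine ⟨Kiᴴ * P.submatrix f f * Ki, (hP.submatrix f).conjTranspose_mul_mul_same Ki, ?_, ?_⟩
  · have h1 := (hPZ.submatrix f).conjTranspose_mul_mul_same Ki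
    have h2 : Kiᴴ * Kᴴ = 1 := by rw [← conjTranspose_mul, hKKi, conjTranspose_one]
    have h3 : Kiᴴ * (P - Z).submatrix f f * Ki = Kiᴴ * P.submatrix f f * Ki - choi F := by
      have : (P - Z).submatrix f f = P.submatrix f f - Kᴴ * choi F * K := by
        rw [← hZK]; rfl
      rw [this, mul_sub, sub_mul]
      congr 1
      calc Kiᴴ * (Kᴴ * choi F * K) * Ki = (Kiᴴ * Kᴴ) * choi F * (K * Ki) := by noncomm_ring
        _ = choi F := by rw [h2, hKKi]; simp
    rwa [h3] at h1
  · have h4 : ρ ⊗ₖ (1 : Matrix β β ℂ) = K * Kᴴ := by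
      rw [hK, conjTranspose_kronecker, ← mul_kronecker_mul, hT]
      simp
    have h5 : Kᴴ * Kiᴴ = 1 := by rw [← conjTranspose_mul, hKiK, conjTranspose_one]
    have h6 : (ρ * traceRight (Kiᴴ * P.submatrix f f * Ki)).trace = P.trace := by
      rw [trace_mul_traceRight, h4]
      calc (K * Kᴴ * (Kiᴴ * P.submatrix f f * Ki)).trace
          = (K * ((Kᴴ * Kiᴴ) * P.submatrix f f * Ki)).trace := by congr 1; noncomm_ring
        _ = ((Kᴴ * Kiᴴ) * P.submatrix f f * (Ki * K)).trace := by
          rw [trace_mul_comm, Matrix.mul_assoc]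
        _ = (P.submatrix f f).trace := by rw [h5, hKiK]; simp
        _ = P.trace := by
          simp only [Matrix.trace, diag_apply, submatrix_apply]
          exact f.sum_comp fun i => P i i
    rw [h6, hPt]
    linarith

/-- The states are the image of the Frobenius unit sphere under $T\mapsto T^*T$. -/
theorem isCompact_setOf_isState : IsCompact {ρ : Matrix α α ℂ | IsState ρ} := by
  have h1 : IsCompact {T : α → α → ℂ | ∑ i, ∑ j, ‖T i j‖ ^ 2 = 1} := by
    refine Metric.isCompact_of_isClosed_isBounded
      (isClosed_eq (by fun_prop) continuous_const) ?_
    refine (Metric.isBounded_closedBall (x := (0 : α → α → ℂ)) (r := 1)).subset fun T hT => ?_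
    rw [mem_closedBall_zero_iff, pi_norm_le_iff_of_nonneg zero_le_one]
    intro i
    rw [pi_norm_le_iff_of_nonneg zero_le_one]
    intro j
    have h2 : ‖T i j‖ ^ 2 ≤ ∑ i, ∑ j, ‖T i j‖ ^ 2 :=
      (Finset.single_le_sum (f := fun j => ‖T i j‖ ^ 2) (fun _ _ => by positivity)
        (Finset.mem_univ j)).trans
      (Finset.single_le_sum (f := fun i => ∑ j, ‖T i j‖ ^ 2) (fun _ _ => by positivity)
        (Finset.mem_univ i))
    rw [show ∑ i, ∑ j, ‖T i j‖ ^ 2 = 1 from hT] at h2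
    exact (sq_le_one_iff₀ (norm_nonneg _)).1 h2
  have htr : ∀ T : Matrix α α ℂ, (Tᴴ * T).trace = ((∑ i, ∑ j, ‖T i j‖ ^ 2 : ℝ) : ℂ) := by
    intro T
    simp only [Matrix.trace, diag_apply, Matrix.mul_apply, conjTranspose_apply]
    rw [Finset.sum_comm]
    push_cast
    refine Finset.sum_congr rfl fun i _ => Finset.sum_congr rfl fun j _ => ?_
    exact Complex.conj_mul' _
  have h2 : Continuous fun T : α → α → ℂ => (of T)ᴴ * of T := by
    have : Continuous fun T : α → α → ℂ => (of T : Matrix α α ℂ) := continuous_id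
    fun_prop
  convert h1.image h2 using 1
  ext ρ
  constructor
  · rintro ⟨h, ht⟩
    obtain ⟨T, hT⟩ := CStarAlgebra.nonneg_iff_eq_star_mul_self.mp h
    refine ⟨T, ?_, hT.symm⟩
    rw [hT, star_eq_conjTranspose, htr] at ht
    exact_mod_cast ht
  · rintro ⟨T, hT, rfl⟩
    refine ⟨(posSemidef_conjTranspose_mul_self _).nonneg, ?_⟩
    change ∑ i, ∑ j, ‖T i j‖ ^ 2 = 1 at hT
    have := htr (of T)
    simp only [of_apply, hT] at this
    simpa using this

end StrongDuality

/-! ### Minimax: one dual point for all states -/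

section Minimax

variable {α β : Type*} [Fintype β]

theorem posSemidef_traceRight {Y : Matrix (α × β) (α × β) ℂ} (hY : Y.PosSemidef) :
    (traceRight Y).PosSemidef := by
  have h := posSemidef_sum (Finset.univ : Finset β) (x := fun b => Y.submatrix (fun a => (a, b))
    (fun a => (a, b))) fun b _ => hY.submatrix _
  convert h using 1
  ext a a'
  simp [traceRight, Matrix.sum_apply]

theorem vecMulVec_single_single [DecidableEq α] (i j : α) (x y : ℂ) :
    vecMulVec (Pi.single i x) (Pi.single j y) = single i j (x * y) := by
  ext k l
  simp only [vecMulVec_apply, Pi.single_apply, Matrix.single_apply, mul_ite, ite_mul, mul_zero,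
    zero_mul, eq_comm (a := i), eq_comm (a := j), ite_and]
  split_ifs <;> rfl

variable [Fintype α]

theorem isState_smul_vecMulVec {x : α → ℂ} {c : ℝ} (hc : 0 < c) (h : star x ⬝ᵥ x = (c : ℂ)) :
    IsState (((c⁻¹ : ℝ) : ℂ) • vecMulVec x (star x)) := by
  have h0 : (0 : ℂ) ≤ ((c⁻¹ : ℝ) : ℂ) := by exact_mod_cast (inv_pos.2 hc).le
  refine ⟨((posSemidef_vecMulVec_self_star x).smul h0).nonneg, ?_⟩
  rw [trace_smul, trace_vecMulVec, dotProduct_comm, h, smul_eq_mul, ← Complex.ofReal_mul,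
    inv_mul_cancel₀ hc.ne', Complex.ofReal_one]

theorem isState_single [DecidableEq α] (a : α) : IsState (single a a (1 : ℂ)) := by
  have h := isState_smul_vecMulVec (x := Pi.single a (1 : ℂ)) one_pos (by simp)
  convert h using 1
  ext i j
  rw [Pi.star_single, star_one, vecMulVec_single_single]
  simp

variable [DecidableEq α] [DecidableEq β]

theorem posSemidef_smul_one_sub {M : Matrix α α ℂ} (hM : M.IsHermitian) {γ : ℝ}
    (h : ∀ ρ : Matrix α α ℂ, IsState ρ → (ρ * M).trace.re ≤ γ) :
    ((γ : ℂ) • 1 - M).PosSemidef := by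
  have hH : ((γ : ℂ) • 1 - M).IsHermitian := by
    refine IsHermitian.sub ?_ hM
    simp [IsHermitian, conjTranspose_smul]
  rw [posSemidef_iff_dotProduct_mulVec]
  refine ⟨hH, fun x => ?_⟩
  by_cases hx : x = 0
  · simp [hx]
  have hpos := Complex.lt_def.1 (dotProduct_star_self_pos_iff.2 hx)
  set c : ℝ := (star x ⬝ᵥ x).re with hc
  have hc0 : 0 < c := hpos.1
  have hc1 : star x ⬝ᵥ x = (c : ℂ) := Complex.ext rfl hpos.2.symm
  have h1 := h _ (isState_smul_vecMulVec hc0 hc1)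
  have h2 : (vecMulVec x (star x) * M).trace = star x ⬝ᵥ M *ᵥ x := by
    rw [vecMulVec_mul, trace_vecMulVec, dotProduct_comm, dotProduct_mulVec]
  rw [smul_mul, trace_smul, h2, smul_eq_mul, Complex.re_ofReal_mul, inv_mul_le_iff₀ hc0] at h1
  have h3 : star x ⬝ᵥ ((γ : ℂ) • 1 - M) *ᵥ x = (γ : ℂ) * c - star x ⬝ᵥ M *ᵥ x := by
    rw [sub_mulVec, smul_mulVec, one_mulVec, dotProduct_sub, dotProduct_smul, hc1, smul_eq_mul]
  have h4 : (star x ⬝ᵥ M *ᵥ x).im = 0 := hM.im_star_dotProduct_mulVec_self x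
  rw [h3]
  refine Complex.le_def.2 ⟨?_, ?_⟩
  · rw [Complex.sub_re, ← Complex.ofReal_mul, Complex.ofReal_re, Complex.zero_re]
    linarith
  · rw [Complex.sub_im, ← Complex.ofReal_mul, Complex.ofReal_im, h4, Complex.zero_im, sub_zero]

/-- Removes faithfulness by mixing $\rho$ with a little of the identity; the slack $g-d/2$ absorbs
the cost. -/
theorem exists_dual_point_state {F : SuperOp α β} {d g : ℝ} (hd : 0 ≤ d)
    (hF : diamondNorm F ≤ ENNReal.ofReal d) (hJ : (choi F).IsHermitian)
    (hJ0 : traceRight (choi F) = 0) (hg : d / 2 < g) {ρ : Matrix α α ℂ} (hρ : IsState ρ) :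
    ∃ Y : Matrix (α × β) (α × β) ℂ, (Y.PosSemidef ∧ (Y - choi F).PosSemidef) ∧
      (ρ * traceRight Y).trace.re < g := by
  have : Nonempty α := by
    by_contra h
    rw [not_nonempty_iff] at h
    simpa [Matrix.trace] using hρ.trace_one
  set n : ℝ := (Fintype.card α : ℝ) with hn
  have hn0 : 0 < n := by rw [hn]; exact_mod_cast Fintype.card_pos
  -- Chosen so that $(1+\delta n)\,d/2<g$, where $1+\delta n$ is the trace of $\rho+\delta 1$.
  set δ : ℝ := (g - d / 2) / (n * (d / 2 + 1)) with hδ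
  have hδ0 : 0 < δ := div_pos (by linarith) (by positivity)
  set s : ℝ := 1 + δ * n with hs
  have hs0 : 0 < s := by positivity
  have hsg : s * (d / 2) < g := by
    have h1 : δ * n * (d / 2 + 1) = g - d / 2 := by
      rw [hδ]
      field_simp
    nlinarith [mul_pos hδ0 hn0]
  have hpd : (((s⁻¹ : ℝ) : ℂ) • (ρ + (δ : ℂ) • 1)).PosDef := by
    have h1 : (0 : ℂ) < (δ : ℂ) := by exact_mod_cast hδ0
    have h2 : (0 : ℂ) < ((s⁻¹ : ℝ) : ℂ) := by exact_mod_cast inv_pos.2 hs0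
    exact ((PosDef.one.smul h1).posSemidef_add (nonneg_iff_posSemidef.1 hρ.nonneg)).smul h2
  have htr : (((s⁻¹ : ℝ) : ℂ) • (ρ + (δ : ℂ) • 1)).trace = 1 := by
    rw [trace_smul, trace_add, hρ.trace_one, trace_smul, trace_one, smul_eq_mul, smul_eq_mul]
    have : (1 + (δ : ℂ) * (Fintype.card α : ℂ)) = (s : ℂ) := by rw [hs, hn]; push_cast; rfl
    rw [this, ← Complex.ofReal_mul, inv_mul_cancel₀ hs0.ne', Complex.ofReal_one]
  obtain ⟨Y, hY, hYF, h⟩ := exists_dual_point_of_posDef hd hF hJ hJ0 hpd htr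
  refine ⟨Y, ⟨hY, hYF⟩, ?_⟩
  have ht := (Complex.le_def.1 (posSemidef_traceRight hY).trace_nonneg).1
  rw [smul_mul, trace_smul, smul_eq_mul, Complex.re_ofReal_mul, add_mul, smul_mul, one_mul,
    trace_add, trace_smul, smul_eq_mul, Complex.add_re, Complex.re_ofReal_mul,
    inv_mul_le_iff₀ hs0] at h
  have := mul_nonneg hδ0.le ht
  linarith

/-- By the minimax theorem there is a dual point that is good for all input states. -/
theorem exists_dual_point {F : SuperOp α β} {d g : ℝ} (hd : 0 ≤ d)
    (hF : diamondNorm F ≤ ENNReal.ofReal d) (hJ : (choi F).IsHermitian)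
    (hJ0 : traceRight (choi F) = 0) (hg : d / 2 < g) [Nonempty α] :
    ∃ Y : Matrix (α × β) (α × β) ℂ, Y.PosSemidef ∧ (Y - choi F).PosSemidef ∧
      ((g : ℂ) • 1 - traceRight Y).PosSemidef := by
  let D : Set (Matrix (α × β) (α × β) ℂ) := {Y | Y.PosSemidef ∧ (Y - choi F).PosSemidef}
  let S : Set (Matrix α α ℂ) := {ρ | IsState ρ}
  -- The sign turns the sought upper bound over all states into the lower bound that Sion's theorem
  -- delivers.
  let f : Matrix α α ℂ → Matrix (α × β) (α × β) ℂ → ℝ := fun ρ Y => -(ρ * traceRight Y).trace.re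
  have hpoint : ∀ ρ : Matrix α α ℂ, ∃ Y, ρ ∈ S → Y ∈ D ∧ -g < f ρ Y := by
    intro ρ
    by_cases hρ : ρ ∈ S
    · obtain ⟨Y, hY, h⟩ := exists_dual_point_state hd hF hJ hJ0 hg hρ
      exact ⟨Y, fun _ => ⟨hY, neg_lt_neg h⟩⟩
    · exact ⟨0, fun h => absurd h hρ⟩
  choose y hy using hpoint
  have hcont1 : ∀ Y, Continuous fun ρ => f ρ Y := fun Y =>
    (Complex.continuous_re.comp (Continuous.matrix_trace (continuous_id.matrix_mul
      continuous_const))).neg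
  have hcont2 : ∀ ρ, Continuous fun Y => f ρ Y := by
    intro ρ
    have : Continuous fun Y : Matrix (α × β) (α × β) ℂ => traceRight Y := by
      refine continuous_matrix fun a a' => ?_
      simp only [traceRight, of_apply]
      exact continuous_finsetSum _ fun b _ => continuous_id.matrix_elem _ _
    exact (Complex.continuous_re.comp (Continuous.matrix_trace (continuous_const.matrix_mul
      this))).neg
  have hlin1 : ∀ Y (a b : ℝ) (ρ σ : Matrix α α ℂ),
      f (a • ρ + b • σ) Y = a * f ρ Y + b * f σ Y := by
    intro Y a b ρ σ
    simp [f, add_mul]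
    ring
  have htl : ∀ (a b : ℝ) (Y Z : Matrix (α × β) (α × β) ℂ),
      traceRight (a • Y + b • Z) = a • traceRight Y + b • traceRight Z := by
    intro a b Y Z
    ext
    simp [traceRight, Finset.sum_add_distrib, Finset.mul_sum]
  have hlin2 : ∀ ρ (a b : ℝ) (Y Z : Matrix (α × β) (α × β) ℂ),
      f ρ (a • Y + b • Z) = a * f ρ Y + b * f ρ Z := by
    intro ρ a b Y Z
    simp [f, htl, mul_add]
    ring
  have hS : IsCompact S := isCompact_setOf_isState
  have hSc : Convex ℝ S := by
    intro ρ hρ σ hσ a b ha hb hab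
    refine ⟨?_, ?_⟩
    · exact (((nonneg_iff_posSemidef.1 hρ.nonneg).smul ha).add
        ((nonneg_iff_posSemidef.1 hσ.nonneg).smul hb)).nonneg
    · rw [trace_add, trace_smul, trace_smul, hρ.trace_one, hσ.trace_one, ← add_smul, hab, one_smul]
  have hDc : Convex ℝ D := by
    intro Y hY Z hZ a b ha hb hab
    refine ⟨(hY.1.smul ha).add (hZ.1.smul hb), ?_⟩
    have : a • Y + b • Z - choi F = a • (Y - choi F) + b • (Z - choi F) := by
      conv_lhs => rw [← one_smul ℝ (choi F), ← hab]
      module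
    rw [this]
    exact (hY.2.smul ha).add (hZ.2.smul hb)
  have hSne : S.Nonempty := by
    obtain ⟨a⟩ := ‹Nonempty α›
    exact ⟨single a a 1, isState_single a⟩
  -- `D` is not compact, but the states are, so finitely many of the pointwise choices `y ρ` already
  -- serve every state.
  obtain ⟨t, htS, htc⟩ := hS.elim_nhds_subcover (fun ρ => {σ | -g < f σ (y ρ)}) fun ρ hρ =>
    (isOpen_lt continuous_const (hcont1 (y ρ))).mem_nhds (hy ρ hρ).2
  obtain ⟨Y, hY, h⟩ := Sion.exists_lt_iInf_of_lt_iInf_of_finite (X := S) (Y := D) (f := f)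
    hSne hS (fun Y _ => (hcont1 Y).lowerSemicontinuous.lowerSemicontinuousOn _)
    (fun Y _ => ConvexOn.quasiconvexOn ⟨hSc, fun ρ _ σ _ a b _ _ _ => (hlin1 Y a b ρ σ).le⟩)
    hDc (fun ρ _ => (hcont2 ρ).upperSemicontinuous.upperSemicontinuousOn _)
    (fun ρ _ => ConcaveOn.quasiconcaveOn ⟨hDc, fun Y _ Z _ a b _ _ _ => (hlin2 ρ a b Y Z).ge⟩)
    hSc (s := y '' t) (t.finite_toSet.image y) (by
      rintro _ ⟨ρ, hρ, rfl⟩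
      exact (hy ρ (htS ρ hρ)).1) (t := -g) (by
      intro σ hσ
      obtain ⟨ρ, hρ, hlt⟩ := Set.mem_iUnion₂.1 (htc hσ)
      exact ⟨y ρ, ⟨ρ, hρ, rfl⟩, hlt⟩)
  refine ⟨Y, hY.1, hY.2, posSemidef_smul_one_sub (posSemidef_traceRight hY.1).isHermitian
    fun ρ hρ => ?_⟩
  have := h ρ hρ
  simp only [f] at this
  linarith

end Minimax

/-! ### No-signalling in terms of Choi matrices -/

section NoSignalling

/-- Diagonal matrix units are states. Testing `L` on the pure states along $e_a+c\,e_{a'}$ with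
$c=1$ and $c=i$ shows that it kills the off-diagonal units. -/
theorem map_eq_trace_smul_of_isState {α W : Type*} [Fintype α] [DecidableEq α] [AddCommGroup W]
    [Module ℂ W] (L : Matrix α α ℂ →ₗ[ℂ] W) (h : ∀ ρ σ, IsState ρ → IsState σ → L ρ = L σ)
    (a₀ : α) (X : Matrix α α ℂ) : L X = X.trace • L (single a₀ a₀ 1) := by
  have hdiag : ∀ a, L (single a a 1) = L (single a₀ a₀ 1) := fun a =>
    h _ _ (isState_single a) (isState_single a₀)
  have hoff : ∀ a a', a ≠ a' → L (single a a' 1) = 0 := by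
    intro a a' hne
    have key : ∀ c : ℂ, star c * c = 1 →
        star c • L (single a a' 1) + c • L (single a' a 1) = 0 := by
      intro c hc
      have h1 : star (Pi.single a 1 + Pi.single a' c : α → ℂ) ⬝ᵥ (Pi.single a 1 + Pi.single a' c)
          = ((2 : ℝ) : ℂ) := by
        simp only [star_add, Pi.star_single, star_one, add_dotProduct, single_dotProduct,
          Pi.add_apply, Pi.single_eq_same, Pi.single_eq_of_ne hne, Pi.single_eq_of_ne hne.symm]
        simp only [one_mul, add_zero, zero_add, hc]
        norm_num
      have h2 : vecMulVec (Pi.single a 1 + Pi.single a' c : α → ℂ)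
          (star (Pi.single a 1 + Pi.single a' c)) = single a a 1 + star c • single a a' 1 +
            c • single a' a 1 + single a' a' 1 := by
        simp only [star_add, Pi.star_single, star_one, vecMulVec_add, add_vecMulVec,
          vecMulVec_single_single, smul_single, smul_eq_mul, mul_one, one_mul]
        rw [mul_comm c, hc]
        abel
      have h3 := h _ _ (isState_smul_vecMulVec two_pos h1) (isState_single a₀)
      rw [h2, map_smul, map_add, map_add, map_add, map_smul, map_smul, hdiag a, hdiag a'] at h3
      have h4 : (2 : ℂ) • (((2⁻¹ : ℝ) : ℂ) • (L (single a₀ a₀ 1) + star c • L (single a a' 1) +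
          c • L (single a' a 1) + L (single a₀ a₀ 1))) = (2 : ℂ) • L (single a₀ a₀ 1) := by rw [h3]
      rw [smul_smul, show (2 : ℂ) * ((2⁻¹ : ℝ) : ℂ) = 1 by norm_num, one_smul, two_smul] at h4
      have h5 : star c • L (single a a' 1) + c • L (single a' a 1) =
          (L (single a₀ a₀ 1) + star c • L (single a a' 1) + c • L (single a' a 1) +
            L (single a₀ a₀ 1)) - (L (single a₀ a₀ 1) + L (single a₀ a₀ 1)) := by abel
      rw [h5, h4, sub_self]
    have k1 := key 1 (by simp)
    have k2 := key Complex.I (by simp)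
    rw [star_one, one_smul, one_smul] at k1
    have k3 : L (single a' a 1) = -L (single a a' 1) := (neg_eq_of_add_eq_zero_right k1).symm
    rw [k3, Complex.star_def, Complex.conj_I] at k2
    have k4 : (-2 * Complex.I) • L (single a a' 1) = 0 := by
      rw [← k2]
      module
    exact (smul_eq_zero.1 k4).resolve_left (by simp)
  conv_lhs => rw [matrix_eq_sum_single X]
  simp only [map_sum]
  rw [Matrix.trace, Finset.sum_smul]
  refine Finset.sum_congr rfl fun a _ => ?_
  rw [Finset.sum_eq_single a]
  · rw [diag_apply, ← hdiag a, ← map_smul, smul_single, smul_eq_mul, mul_one]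
  · intro a' _ hne
    rw [← mul_one (X a a'), ← smul_eq_mul, ← smul_single, map_smul, hoff a a' hne.symm, smul_zero]
  · simp

variable {Ai Bi Ao Bo : Type*}

/-- In Choi form, no signalling from $B$ says that $\mathrm{tr}_{B_o}J_\Pi$ is the identity on $B_i$
tensored with an operator on $A_iA_o$. -/
theorem NoSignalBA.sum_choi [DecidableEq Ai] [Fintype Bi] [DecidableEq Bi] [Fintype Bo]
    {P : SuperOp (Ai × Bi) (Ao × Bo)} (h : NoSignalBA P) (i₀ : Bi)
    (a a' : Ai) (i i' : Bi) (o o' : Ao) :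
    ∑ b, choi P ((a, i), (o, b)) ((a', i'), (o', b)) =
      if i = i' then ∑ b, choi P ((a, i₀), (o, b)) ((a', i₀), (o', b)) else 0 := by
  let L : Matrix Bi Bi ℂ →ₗ[ℂ] Matrix Ao Ao ℂ :=
    { toFun := fun σ => traceRight (P (single a a' 1 ⊗ₖ σ))
      map_add' := fun σ τ => by
        ext
        simp [traceRight, kronecker_add, Finset.sum_add_distrib]
      map_smul' := fun c σ => by
        ext
        simp [traceRight, kronecker_smul, Finset.mul_sum] }
  have h1 := map_eq_trace_smul_of_isState L (fun ρ σ hρ hσ => h _ ρ σ hρ hσ) i₀ (single i i' 1)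
  have h2 : ∀ j j', L (single j j' 1) o o' =
      ∑ b, choi P ((a, j), (o, b)) ((a', j'), (o', b)) := by
    intro j j'
    change traceRight (P (single a a' 1 ⊗ₖ single j j' 1)) o o' = _
    rw [single_kronecker_single, one_mul]
    rfl
  have h3 := congrFun (congrFun h1 o) o'
  rw [h2, Matrix.smul_apply, h2] at h3
  rw [h3]
  by_cases hi : i = i'
  · subst hi
    simp
  · simp [hi, trace_single_eq_of_ne]

theorem NoSignalAB.sum_choi [Fintype Ai] [DecidableEq Ai] [DecidableEq Bi] [Fintype Ao]
    {P : SuperOp (Ai × Bi) (Ao × Bo)} (h : NoSignalAB P) (a₀ : Ai)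
    (a a' : Ai) (i i' : Bi) (b b' : Bo) :
    ∑ o, choi P ((a, i), (o, b)) ((a', i'), (o, b')) =
      if a = a' then ∑ o, choi P ((a₀, i), (o, b)) ((a₀, i'), (o, b')) else 0 := by
  let L : Matrix Ai Ai ℂ →ₗ[ℂ] Matrix Bo Bo ℂ :=
    { toFun := fun ρ => traceLeft (P (ρ ⊗ₖ single i i' 1))
      map_add' := fun σ τ => by
        ext
        simp [traceLeft, add_kronecker, Finset.sum_add_distrib]
      map_smul' := fun c σ => by
        ext
        simp [traceLeft, smul_kronecker, Finset.mul_sum] }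
  have h1 := map_eq_trace_smul_of_isState L (fun ρ σ hρ hσ => h ρ σ _ hρ hσ) a₀ (single a a' 1)
  have h2 : ∀ c c', L (single c c' 1) b b' =
      ∑ o, choi P ((c, i), (o, b)) ((c', i'), (o, b')) := by
    intro c c'
    change traceLeft (P (single c c' 1 ⊗ₖ single i i' 1)) b b' = _
    rw [single_kronecker_single, one_mul]
    rfl
  have h3 := congrFun (congrFun h1 b) b'
  rw [h2, Matrix.smul_apply, h2] at h3
  rw [h3]
  by_cases hi : a = a'
  · subst hi
    simp
  · simp [hi, trace_single_eq_of_ne]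

theorem noSignalBA_ofChoi [Fintype Ai] [Fintype Bi] [DecidableEq Bi] [Fintype Bo]
    {J : Matrix ((Ai × Bi) × (Ao × Bo)) ((Ai × Bi) × (Ao × Bo)) ℂ}
    (R : Ai → Ai → Ao → Ao → ℂ)
    (h : ∀ a a' i i' o o', ∑ b, J ((a, i), (o, b)) ((a', i'), (o', b)) =
      if i = i' then R a a' o o' else 0) : NoSignalBA (ofChoi J) := by
  have key : ∀ (ρ : Matrix Ai Ai ℂ) (σ : Matrix Bi Bi ℂ) (o o' : Ao),
      traceRight (ofChoi J (ρ ⊗ₖ σ)) o o' = (∑ a, ∑ a', ρ a a' * R a a' o o') * σ.trace := by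
    intro ρ σ o o'
    have : traceRight (ofChoi J (ρ ⊗ₖ σ)) o o' = ∑ a, ∑ i, ∑ a', ∑ i',
        ρ a a' * σ i i' * ∑ b, J ((a, i), (o, b)) ((a', i'), (o', b)) := by
      simp only [traceRight, ofChoi, LinearMap.coe_mk, AddHom.coe_mk, of_apply,
        Fintype.sum_prod_type, kroneckerMap_apply, Finset.mul_sum]
      rw [Finset.sum_comm]
      refine Finset.sum_congr rfl fun a _ => ?_
      rw [Finset.sum_comm]
      refine Finset.sum_congr rfl fun i _ => ?_
      rw [Finset.sum_comm]
      refine Finset.sum_congr rfl fun a' _ => ?_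
      rw [Finset.sum_comm]
    rw [this]
    simp only [h, mul_ite, mul_zero, Finset.sum_ite_eq, Finset.mem_univ, if_true]
    rw [Finset.sum_mul]
    refine Finset.sum_congr rfl fun a _ => ?_
    rw [Finset.sum_mul, Finset.sum_comm]
    refine Finset.sum_congr rfl fun a' _ => ?_
    rw [Matrix.trace, Finset.mul_sum]
    exact Finset.sum_congr rfl fun i _ => by rw [diag_apply]; ring
  intro ρ σ₁ σ₂ h1 h2
  ext o o'
  rw [key, key, h1.trace_one, h2.trace_one]

theorem noSignalAB_ofChoi [Fintype Ai] [DecidableEq Ai] [Fintype Bi] [Fintype Ao]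
    {J : Matrix ((Ai × Bi) × (Ao × Bo)) ((Ai × Bi) × (Ao × Bo)) ℂ}
    (K : Bi → Bi → Bo → Bo → ℂ)
    (h : ∀ a a' i i' b b', ∑ o, J ((a, i), (o, b)) ((a', i'), (o, b')) =
      if a = a' then K i i' b b' else 0) : NoSignalAB (ofChoi J) := by
  have key : ∀ (ρ : Matrix Ai Ai ℂ) (σ : Matrix Bi Bi ℂ) (b b' : Bo),
      traceLeft (ofChoi J (ρ ⊗ₖ σ)) b b' = ρ.trace * ∑ i, ∑ i', σ i i' * K i i' b b' := by
    intro ρ σ b b'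
    have : traceLeft (ofChoi J (ρ ⊗ₖ σ)) b b' = ∑ a, ∑ i, ∑ a', ∑ i',
        ρ a a' * σ i i' * ∑ o, J ((a, i), (o, b)) ((a', i'), (o, b')) := by
      simp only [traceLeft, ofChoi, LinearMap.coe_mk, AddHom.coe_mk, of_apply,
        Fintype.sum_prod_type, kroneckerMap_apply, Finset.mul_sum]
      rw [Finset.sum_comm]
      refine Finset.sum_congr rfl fun a _ => ?_
      rw [Finset.sum_comm]
      refine Finset.sum_congr rfl fun i _ => ?_
      rw [Finset.sum_comm]
      refine Finset.sum_congr rfl fun a' _ => ?_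
      rw [Finset.sum_comm]
    rw [this]
    simp only [h, mul_ite, mul_zero]
    rw [Matrix.trace, Finset.sum_mul]
    refine Finset.sum_congr rfl fun a _ => ?_
    rw [Finset.mul_sum]
    refine Finset.sum_congr rfl fun i _ => ?_
    rw [Finset.sum_eq_single a, Finset.mul_sum]
    · simp [mul_assoc]
    · intro c _ hc
      simp [hc.symm]
    · simp
  intro ρ₁ ρ₂ σ h1 h2
  ext b b'
  rw [key, key, h1.trace_one, h2.trace_one]

end NoSignalling

/-! ### The maximally entangled operator and the flip -/

section MaxEntangled

variable (κ : Type*) [DecidableEq κ]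

/-- The unnormalised maximally entangled vector on `κ ⊗ κ`. -/
def maxEnt : κ × κ → ℂ := fun p => if p.1 = p.2 then 1 else 0

/-- The flip operator on `κ ⊗ κ`. -/
def flip : Matrix (κ × κ) (κ × κ) ℂ := (1 : Matrix (κ × κ) (κ × κ) ℂ).submatrix Prod.swap id

theorem flip_apply (i o i' o' : κ) : flip κ (i, o) (i', o') =
    (if i = o' then 1 else 0) * (if o = i' then 1 else 0) := by
  simp only [flip, submatrix_apply, id_eq, Prod.swap_prod_mk, Matrix.one_apply, Prod.mk.injEq,
    ite_and, mul_ite, mul_one, mul_zero]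

theorem vecMulVec_maxEnt_apply (i o i' o' : κ) :
    vecMulVec (maxEnt κ) (maxEnt κ) (i, o) (i', o') =
    (if i = o then 1 else 0) * (if i' = o' then 1 else 0) := rfl

theorem one_apply_prod (i o i' o' : κ) : (1 : Matrix (κ × κ) (κ × κ) ℂ) (i, o) (i', o') =
    (if i = i' then 1 else 0) * (if o = o' then 1 else 0) := by
  by_cases h : i = i' <;> simp [Matrix.one_apply, h]

theorem star_maxEnt : star (maxEnt κ) = maxEnt κ := by
  ext p
  simp [maxEnt, apply_ite (starRingEnd ℂ)]

variable [Fintype κ]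

theorem posSemidef_maxEnt : (vecMulVec (maxEnt κ) (maxEnt κ)).PosSemidef := by
  have := posSemidef_vecMulVec_self_star (maxEnt κ)
  rwa [star_maxEnt] at this

/-- With $d$ the dimension, $Q^2=dQ$, so $M=d1-Q$ satisfies $M^*M=dM$. -/
theorem posSemidef_card_smul_one_sub_maxEnt :
    ((Fintype.card κ : ℂ) • 1 - vecMulVec (maxEnt κ) (maxEnt κ)).PosSemidef := by
  rcases isEmpty_or_nonempty κ with h | h
  · convert PosSemidef.zero (n := κ × κ) (R := ℂ)
    ext p
    exact isEmptyElim p.1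
  have hc : (Fintype.card κ : ℂ) ≠ 0 := by simp
  set Q := vecMulVec (maxEnt κ) (maxEnt κ) with hQ
  have hQQ : Q * Q = (Fintype.card κ : ℂ) • Q := by
    rw [hQ, vecMulVec_mul_vecMulVec]
    have : maxEnt κ ⬝ᵥ maxEnt κ = (Fintype.card κ : ℂ) := by
      simp [dotProduct, maxEnt, Fintype.sum_prod_type]
    rw [this]
    ext
    simp [vecMulVec_apply, mul_left_comm]
  have hQs : Qᴴ = Q := (posSemidef_maxEnt κ).isHermitian
  set M := (Fintype.card κ : ℂ) • 1 - Q with hM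
  have hMs : Mᴴ = M := by rw [hM, conjTranspose_sub, hQs]; simp [conjTranspose_smul]
  have hMM : Mᴴ * M = (Fintype.card κ : ℂ) • M := by
    rw [hMs, hM, sub_mul, mul_sub, mul_sub, hQQ]
    simp only [Matrix.smul_mul, Matrix.mul_smul, Matrix.one_mul, Matrix.mul_one, smul_sub]
    abel
  have : M = (Fintype.card κ : ℂ)⁻¹ • (Mᴴ * M) := by
    rw [hMM, smul_smul, inv_mul_cancel₀ hc, one_smul]
  rw [this]
  have h0 : (0 : ℂ) ≤ (Fintype.card κ : ℂ)⁻¹ := by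
    have : (0 : ℝ) ≤ (Fintype.card κ : ℝ)⁻¹ := by positivity
    rw [← Complex.ofReal_natCast, ← Complex.ofReal_inv]
    exact_mod_cast this
  exact (posSemidef_conjTranspose_mul_self M).smul h0

/-- The flip is a Hermitian involution, so $1+\varepsilon F$ is half its own square. The parameter
treats both signs $\varepsilon=\pm1$ at once. -/
theorem posSemidef_one_add_flip {ε : ℂ} (hε : ε * ε = 1) (hs : star ε = ε) :
    (1 + ε • flip κ).PosSemidef := by
  have h1 : flip κ * flip κ = 1 := by
    ext p q
    simp [flip, Matrix.mul_apply, Matrix.one_apply, Prod.swap_eq_iff_eq_swap]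
  have h2 : (flip κ)ᴴ = flip κ := by
    ext p q
    simp [flip, Matrix.one_apply, apply_ite (starRingEnd ℂ), Prod.swap_eq_iff_eq_swap,
      eq_comm (a := p)]
  have h3 : 1 + ε • flip κ = (2⁻¹ : ℂ) • ((1 + ε • flip κ)ᴴ * (1 + ε • flip κ)) := by
    rw [conjTranspose_add, conjTranspose_smul, h2, hs, conjTranspose_one, add_mul, mul_add,
      mul_add, Matrix.smul_mul, Matrix.smul_mul, Matrix.mul_smul, Matrix.mul_smul, h1, smul_smul,
      hε]
    simp only [one_mul, mul_one, one_smul]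
    module
  rw [h3]
  have h0 : (0 : ℂ) ≤ 2⁻¹ := by
    have : (0 : ℝ) ≤ 2⁻¹ := by positivity
    rw [show (2⁻¹ : ℂ) = ((2⁻¹ : ℝ) : ℂ) by norm_num]
    exact_mod_cast this
  exact (posSemidef_conjTranspose_mul_self _).smul h0

end MaxEntangled

/-! ### From codes to feasible points -/

section CodeToProgram

variable {A B : Type*} {m : ℕ}

theorem choi_plug_id [DecidableEq A] (P : SuperOp (A × Fin m) (Fin m × B)) (a a' : A) (b b' : B) :
    choi (plug P (idChannel m)) (a, b) (a', b') =
      ∑ o, ∑ o', choi P ((a, o), (o, b)) ((a', o'), (o', b')) := by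
  simp only [choi, plug, LinearMap.coe_mk, AddHom.coe_mk, of_apply, idChannel, LinearMap.id_apply,
    single_kronecker_single, mul_one]
  refine Finset.sum_congr rfl fun o _ => Finset.sum_congr rfl fun o' _ => ?_
  rw [Finset.sum_eq_single o, Finset.sum_eq_single o']
  · simp
  · intro i _ hi
    simp [hi.symm]
  · simp
  · intro i _ hi
    simp [hi.symm]
  · simp

variable [Fintype A] [DecidableEq A]

/-- The matrix `m tr_{Ao Bi}` of the part of the code's Choi matrix that does not depend on the
input at `A`. -/
def codeMarginal (P : SuperOp (A × Fin m) (Fin m × B)) (a₀ : A) : Matrix B B ℂ :=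
  of fun b b' => (m : ℂ) * ∑ i, ∑ o, choi P ((a₀, i), (o, b)) ((a₀, i), (o, b'))

theorem one_kronecker_codeMarginal_apply {P : SuperOp (A × Fin m) (Fin m × B)}
    (hAB : NoSignalAB P) (a₀ a a' : A) (b b' : B) :
    ((1 : Matrix A A ℂ) ⊗ₖ codeMarginal P a₀) (a, b) (a', b') =
      m * ∑ i, ∑ o, choi P ((a, i), (o, b)) ((a', i), (o, b')) := by
  simp only [kroneckerMap_apply, codeMarginal, of_apply, hAB.sum_choi a₀ a a', Matrix.one_apply]
  split_ifs <;> simp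

variable [Fintype B]

theorem IsChannel.sum_choi {P : SuperOp (A × Fin m) (Fin m × B)} (hP : IsChannel P) (a a' : A)
    (i i' : Fin m) : ∑ o, ∑ b, choi P ((a, i), (o, b)) ((a', i'), (o, b)) =
      if a = a' ∧ i = i' then 1 else 0 := by
  have h := congrFun (congrFun hP.traceRight_choi (a, i)) (a', i')
  simp only [traceRight, of_apply, Fintype.sum_prod_type, Matrix.one_apply, Prod.mk.injEq] at h
  exact h

theorem posSemidef_choi_plug {P : SuperOp (A × Fin m) (Fin m × B)} (hP : IsChannel P) :
    (choi (plug P (idChannel m))).PosSemidef := by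
  have h := posSemidef_sum_right (hP.posSemidef_choi.submatrix
    fun p : (A × B) × Fin m => ((p.1.1, p.2), (p.2, p.1.2)))
  convert h using 1
  ext ⟨a, b⟩ ⟨a', b'⟩
  rw [choi_plug_id]
  rfl

/-- No signalling from $B$ removes the terms with $o\ne o'$ and makes the input at $B_i$ irrelevant;
trace preservation of the code at a fixed input `i₀` finishes. -/
theorem traceRight_choi_plug (hm : 1 ≤ m) {P : SuperOp (A × Fin m) (Fin m × B)}
    (hP : IsChannel P) (hBA : NoSignalBA P) : traceRight (choi (plug P (idChannel m))) = 1 := by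
  have i₀ : Fin m := ⟨0, hm⟩
  ext a a'
  simp only [traceRight, of_apply, choi_plug_id]
  rw [Finset.sum_comm]
  have h1 : ∀ o, ∑ b, ∑ o', choi P ((a, o), (o, b)) ((a', o'), (o', b)) =
      ∑ b, choi P ((a, i₀), (o, b)) ((a', i₀), (o, b)) := by
    intro o
    rw [Finset.sum_comm]
    rw [Finset.sum_congr rfl fun o' _ => hBA.sum_choi i₀ a a' o o' o o', Finset.sum_ite_eq,
      if_pos (Finset.mem_univ o)]
  simp only [h1, hP.sum_choi, Matrix.one_apply, and_true]

theorem trace_codeMarginal {P : SuperOp (A × Fin m) (Fin m × B)} (hP : IsChannel P) (a₀ : A) :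
    (codeMarginal P a₀).trace = (m : ℂ) ^ 2 := by
  have : (codeMarginal P a₀).trace =
      m * ∑ i, ∑ o, ∑ b, choi P ((a₀, i), (o, b)) ((a₀, i), (o, b)) := by
    simp only [Matrix.trace, diag_apply, codeMarginal, of_apply]
    rw [← Finset.mul_sum, Finset.sum_comm]
    congr 1
    exact Finset.sum_congr rfl fun i _ => Finset.sum_comm
  rw [this]
  simp [hP.sum_choi, sq]

/-- Contract $J_\Pi$ with $m1-Q\ge 0$: the term $m1$ gives $1\otimes V$ because $A$ cannot signal to
$B$, and $Q$ gives the effective Choi matrix. -/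
theorem posSemidef_one_kronecker_sub_choi_plug {P : SuperOp (A × Fin m) (Fin m × B)}
    (hP : IsChannel P) (hAB : NoSignalAB P) (a₀ : A) :
    ((1 : Matrix A A ℂ) ⊗ₖ codeMarginal P a₀ - choi (plug P (idChannel m))).PosSemidef := by
  have h := posSemidef_contract (posSemidef_card_smul_one_sub_maxEnt (Fin m)) hP.posSemidef_choi
    (fun (_ : A × B) (y : Fin m × Fin m) => y) fun x y => ((x.1, y.1), (y.2, x.2))
  convert h using 1
  ext ⟨a, b⟩ ⟨a', b'⟩
  rw [Matrix.sub_apply, one_kronecker_codeMarginal_apply hAB, choi_plug_id]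
  simp only [of_apply, Matrix.sub_apply, Matrix.smul_apply, vecMulVec_apply, sub_mul,
    Finset.sum_sub_distrib]
  congr 1
  · simp [Matrix.one_apply, Fintype.sum_prod_type, Finset.mul_sum]
  · simp [maxEnt, Fintype.sum_prod_type]

/-- Contract the partially transposed $J_\Pi$ with $1+\varepsilon F\ge 0$. As $F$ is the partial
transpose of $Q$, its term is $\tilde J^{T_B}$; scaling by $m$ turns the other term into $1\otimes
V^T$. -/
theorem posSemidef_one_kronecker_transpose_add {P : SuperOp (A × Fin m) (Fin m × B)}
    (hAB : NoSignalAB P) (hPPT : (of fun p q : (A × Fin m) × (Fin m × B) =>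
      choi P ((p.1.1, q.1.2), (p.2.1, q.2.2)) ((q.1.1, p.1.2), (q.2.1, p.2.2)) :
        Matrix ((A × Fin m) × (Fin m × B)) ((A × Fin m) × (Fin m × B)) ℂ).PosSemidef) (a₀ : A)
    {ε : ℂ} (hε : ε * ε = 1) (hs : star ε = ε) :
    ((1 : Matrix A A ℂ) ⊗ₖ (codeMarginal P a₀)ᵀ +
      ε • (m : ℂ) • transposeRight (choi (plug P (idChannel m)))).PosSemidef := by
  have h := posSemidef_contract (posSemidef_one_add_flip (Fin m) hε hs) hPPT
    (fun (_ : A × B) (y : Fin m × Fin m) => y) fun x y => ((x.1, y.1), (y.2, x.2))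
  have hm : (0 : ℝ) ≤ m := by positivity
  have h2 := h.smul hm
  convert h2 using 1
  ext ⟨a, b⟩ ⟨a', b'⟩
  have h3 : ((1 : Matrix A A ℂ) ⊗ₖ (codeMarginal P a₀)ᵀ) (a, b) (a', b') =
    ((1 : Matrix A A ℂ) ⊗ₖ codeMarginal P a₀) (a, b') (a', b) := rfl
  simp only [Matrix.add_apply, h3, one_kronecker_codeMarginal_apply hAB, Matrix.smul_apply,
    transposeRight, of_apply, choi_plug_id, add_mul, Finset.sum_add_distrib, smul_add]
  congr 1
  · simp [Matrix.one_apply, Fintype.sum_prod_type]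
  · simp only [flip_apply, Fintype.sum_prod_type, Finset.mul_sum, smul_eq_mul, ite_mul, mul_ite,
      zero_mul, mul_one, mul_zero, Finset.sum_ite_eq, Finset.mem_univ, if_true,
      Finset.smul_sum, Finset.sum_ite_irrel, Finset.sum_const_zero]
    rw [Finset.sum_comm]
    refine Finset.sum_congr rfl fun o _ => Finset.sum_congr rfl fun o' _ => ?_
    rw [Complex.real_smul, Complex.ofReal_natCast]
    ring

end CodeToProgram

/-! ### From feasible points to codes -/

section ProgramToCode

variable {A B : Type*} [DecidableEq A] (m : ℕ)

/-- The Choi matrix of the code built from a feasible point of the program. -/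
def codeChoi (J : Matrix (A × B) (A × B) ℂ) (V : Matrix B B ℂ) :
    Matrix ((A × Fin m) × (Fin m × B)) ((A × Fin m) × (Fin m × B)) ℂ :=
  of fun p q =>
    ((m : ℂ) ^ 2)⁻¹ * (vecMulVec (maxEnt (Fin m)) (maxEnt (Fin m)) (p.1.2, p.2.1) (q.1.2, q.2.1) *
      J (p.1.1, p.2.2) (q.1.1, q.2.2)) +
    ((m : ℂ) ^ 2)⁻¹ * ((m : ℂ) ^ 2 - 1)⁻¹ *
      (((m : ℂ) • 1 - vecMulVec (maxEnt (Fin m)) (maxEnt (Fin m)) :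
        Matrix (Fin m × Fin m) (Fin m × Fin m) ℂ) (p.1.2, p.2.1) (q.1.2, q.2.1) *
      ((1 : Matrix A A ℂ) ⊗ₖ V - J) (p.1.1, p.2.2) (q.1.1, q.2.2))

variable {m}

theorem codeChoi_apply (J : Matrix (A × B) (A × B) ℂ) (V : Matrix B B ℂ) (a a' : A)
    (i i' o o' : Fin m) (b b' : B) : codeChoi m J V ((a, i), (o, b)) ((a', i'), (o', b')) =
    ((m : ℂ) ^ 2)⁻¹ * ((if i = o then 1 else 0) * (if i' = o' then 1 else 0) * J (a, b) (a', b')) +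
    ((m : ℂ) ^ 2)⁻¹ * ((m : ℂ) ^ 2 - 1)⁻¹ * ((m * ((if i = i' then 1 else 0) *
      (if o = o' then 1 else 0)) - (if i = o then 1 else 0) * (if i' = o' then 1 else 0)) *
      ((1 : Matrix A A ℂ) ⊗ₖ V - J) (a, b) (a', b')) := by
  simp only [codeChoi, of_apply, vecMulVec_maxEnt_apply, Matrix.sub_apply, Matrix.smul_apply,
    one_apply_prod, smul_eq_mul]

theorem posSemidef_codeChoi (hm : 1 ≤ m) {J : Matrix (A × B) (A × B) ℂ} {V : Matrix B B ℂ}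
    (hJ : J.PosSemidef) (hJV : ((1 : Matrix A A ℂ) ⊗ₖ V - J).PosSemidef) :
    (codeChoi m J V).PosSemidef := by
  have hm1 : (1 : ℝ) ≤ m := by exact_mod_cast hm
  have h1 : (0 : ℝ) ≤ ((m : ℝ) ^ 2)⁻¹ := by positivity
  have h2 : (0 : ℝ) ≤ ((m : ℝ) ^ 2)⁻¹ * ((m : ℝ) ^ 2 - 1)⁻¹ :=
    mul_nonneg h1 (inv_nonneg.2 (by nlinarith))
  have hD := posSemidef_card_smul_one_sub_maxEnt (Fin m)
  rw [Fintype.card_fin] at hD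
  let f : (A × Fin m) × (Fin m × B) → Fin m × Fin m := fun p => (p.1.2, p.2.1)
  let g : (A × Fin m) × (Fin m × B) → A × B := fun p => (p.1.1, p.2.2)
  have h := ((((posSemidef_maxEnt (Fin m)).submatrix f).hadamard (hJ.submatrix g)).smul h1).add
    (((hD.submatrix f).hadamard (hJV.submatrix g)).smul h2)
  refine h.of_apply_eq fun p q => ?_
  simp [codeChoi, f, g]

/-- Contracting with $Q$ annihilates $m1-Q$ and multiplies the $Q\otimes J$ term by $m^2$. -/
theorem choi_plug_codeChoi [Fintype A] (hm : 1 ≤ m) (J : Matrix (A × B) (A × B) ℂ)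
    (V : Matrix B B ℂ) :
    choi (plug (ofChoi (codeChoi m J V)) (idChannel m)) = J := by
  have hm0 : (m : ℂ) ≠ 0 := by
    have : m ≠ 0 := by omega
    exact_mod_cast this
  ext ⟨a, b⟩ ⟨a', b'⟩
  rw [choi_plug_id, choi_ofChoi]
  simp only [codeChoi_apply, if_true, one_mul, Finset.sum_add_distrib, ← Finset.mul_sum,
    ← Finset.sum_mul, Finset.sum_sub_distrib]
  simp
  field_simp

/-- Since $\mathrm{tr}_B(1\otimes V-J)=(m^2-1)1$, the two terms add up to $m^{-2}(Q+m1-Q)\otimes 1$.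
For $m=1$ the operator $m1-Q$ vanishes. -/
theorem sum_codeChoi_right [Fintype B] (hm : 1 ≤ m) {J : Matrix (A × B) (A × B) ℂ}
    {V : Matrix B B ℂ} (h1 : traceRight J = 1) (hV : V.trace = (m : ℂ) ^ 2)
    (a a' : A) (i i' o o' : Fin m) :
    ∑ b, codeChoi m J V ((a, i), (o, b)) ((a', i'), (o', b)) =
      if i = i' then (m : ℂ)⁻¹ * ((if o = o' then 1 else 0) * (if a = a' then 1 else 0)) else 0 := by
  have hJ : ∑ b, J (a, b) (a', b) = if a = a' then 1 else 0 := by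
    have := congrFun (congrFun h1 a) a'
    rwa [Matrix.one_apply] at this
  have hW : ∑ b, ((1 : Matrix A A ℂ) ⊗ₖ V - J) (a, b) (a', b) =
      ((m : ℂ) ^ 2 - 1) * if a = a' then 1 else 0 := by
    simp only [Matrix.sub_apply, kroneckerMap_apply, Finset.sum_sub_distrib, hJ]
    have : ∑ b, (1 : Matrix A A ℂ) a a' * V b b = (1 : Matrix A A ℂ) a a' * V.trace := by
      rw [Matrix.trace, Finset.mul_sum]
      rfl
    rw [this, hV, Matrix.one_apply]
    ring
  simp only [codeChoi_apply]
  rw [Finset.sum_add_distrib, ← Finset.mul_sum, ← Finset.mul_sum, ← Finset.mul_sum,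
    ← Finset.mul_sum, hJ, hW]
  have hm0 : (m : ℂ) ≠ 0 := by
    have : m ≠ 0 := by omega
    exact_mod_cast this
  by_cases h : m = 1
  · subst h
    simp [Subsingleton.elim i o, Subsingleton.elim i' o, Subsingleton.elim o' o]
  · have hm1 : (m : ℂ) ^ 2 - 1 ≠ 0 := by
      have : m ^ 2 ≠ 1 := by
        intro h'
        exact h (by nlinarith)
      rw [sub_ne_zero]
      exact_mod_cast this
    have : (if i = i' then (m : ℂ)⁻¹ * ((if o = o' then 1 else 0) * (if a = a' then 1 else 0))
        else 0) = (m : ℂ)⁻¹ * ((if i = i' then 1 else 0) * (if o = o' then 1 else 0) *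
          (if a = a' then 1 else 0)) := by
      split_ifs <;> simp
    rw [this]
    field_simp
    ring

variable [Fintype A] [Fintype B]

/-- A positive matrix of trace zero vanishes. This covers $m=1$, where $(m^2-1)^{-1}$ takes the
default value $0$. -/
theorem eq_one_kronecker_of_trace {J : Matrix (A × B) (A × B) ℂ} {V : Matrix B B ℂ}
    (hJV : ((1 : Matrix A A ℂ) ⊗ₖ V - J).PosSemidef) (h1 : traceRight J = 1) (hV : V.trace = 1) :
    (1 : Matrix A A ℂ) ⊗ₖ V - J = 0 := by
  rw [← hJV.trace_eq_zero_iff, trace_sub, trace_kronecker, hV, trace_one, mul_one]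
  have : J.trace = (traceRight J).trace := by
    simp [Matrix.trace, traceRight, Fintype.sum_prod_type]
  rw [this, h1, trace_one, sub_self]

theorem card_sq_sub_one_inv_mul {J : Matrix (A × B) (A × B) ℂ} {V : Matrix B B ℂ}
    (hJV : ((1 : Matrix A A ℂ) ⊗ₖ V - J).PosSemidef) (h1 : traceRight J = 1)
    (hV : V.trace = (m : ℂ) ^ 2) (p q : A × B) :
    ((m : ℂ) ^ 2 - 1) * (((m : ℂ) ^ 2 - 1)⁻¹ * ((1 : Matrix A A ℂ) ⊗ₖ V - J) p q) =
      ((1 : Matrix A A ℂ) ⊗ₖ V - J) p q := by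
  by_cases h : (m : ℂ) ^ 2 - 1 = 0
  · rw [eq_one_kronecker_of_trace hJV h1 (by rw [hV]; exact sub_eq_zero.1 h)]
    simp
  · rw [mul_inv_cancel_left₀ h]

/-- Tracing out $A_o$ sends $Q$ to $1$ and $m1-Q$ to $(m^2-1)1$, so $J$ and $1\otimes V-J$ recombine
to $1\otimes V$. -/
theorem sum_codeChoi_left {J : Matrix (A × B) (A × B) ℂ} {V : Matrix B B ℂ}
    (hJV : ((1 : Matrix A A ℂ) ⊗ₖ V - J).PosSemidef) (h1 : traceRight J = 1)
    (hV : V.trace = (m : ℂ) ^ 2) (a a' : A) (i i' : Fin m) (b b' : B) :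
    ∑ o, codeChoi m J V ((a, i), (o, b)) ((a', i'), (o, b')) =
      if a = a' then ((m : ℂ) ^ 2)⁻¹ * ((if i = i' then 1 else 0) * V b b') else 0 := by
  have hw := card_sq_sub_one_inv_mul hJV h1 hV (a, b) (a', b')
  have hv : (if a = a' then ((m : ℂ) ^ 2)⁻¹ * ((if i = i' then 1 else 0) * V b b') else 0) =
      ((m : ℂ) ^ 2)⁻¹ * ((if i = i' then 1 else 0) *
        (((1 : Matrix A A ℂ) ⊗ₖ V - J) (a, b) (a', b') + J (a, b) (a', b'))) := by
    simp [Matrix.one_apply]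
  rw [hv]
  have hq : ∑ o : Fin m, (if i = o then (1 : ℂ) else 0) * (if i' = o then 1 else 0) =
      if i = i' then 1 else 0 := by
    simp
  simp only [codeChoi_apply]
  rw [Finset.sum_add_distrib, ← Finset.mul_sum, ← Finset.mul_sum, ← Finset.sum_mul,
    ← Finset.sum_mul, Finset.sum_sub_distrib, hq]
  simp only [if_true, mul_one, Finset.sum_const, Finset.card_univ, Fintype.card_fin, nsmul_eq_mul]
  linear_combination ((m : ℂ) ^ 2)⁻¹ * (if i = i' then 1 else 0) * hw

theorem isChannel_codeChoi (hm : 1 ≤ m) {J : Matrix (A × B) (A × B) ℂ} {V : Matrix B B ℂ}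
    (hJ : J.PosSemidef) (hJV : ((1 : Matrix A A ℂ) ⊗ₖ V - J).PosSemidef) (h1 : traceRight J = 1)
    (hV : V.trace = (m : ℂ) ^ 2) : IsChannel (ofChoi (codeChoi m J V)) := by
  refine isChannel_ofChoi (posSemidef_codeChoi hm hJ hJV) ?_
  have hm0 : (m : ℂ) ≠ 0 := by
    have : m ≠ 0 := by omega
    exact_mod_cast this
  ext ⟨a, i⟩ ⟨a', i'⟩
  simp only [traceRight, of_apply, Fintype.sum_prod_type, sum_codeChoi_right hm h1 hV,
    Matrix.one_apply, Prod.mk.injEq]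
  by_cases ha : a = a' <;> by_cases hi : i = i' <;> simp [ha, hi, hm0]

theorem ofChoi_codeChoi_mem_NSCodes (hm : 1 ≤ m) {J : Matrix (A × B) (A × B) ℂ}
    {V : Matrix B B ℂ} (hJ : J.PosSemidef) (hJV : ((1 : Matrix A A ℂ) ⊗ₖ V - J).PosSemidef)
    (h1 : traceRight J = 1) (hV : V.trace = (m : ℂ) ^ 2) :
    ofChoi (codeChoi m J V) ∈ NSCodes A (Fin m) (Fin m) B :=
  ⟨isChannel_codeChoi hm hJ hJV h1 hV,
    noSignalAB_ofChoi _ fun a a' i i' b b' => sum_codeChoi_left hJV h1 hV a a' i i' b b',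
    noSignalBA_ofChoi (fun a a' o o' => (m : ℂ)⁻¹ * ((if o = o' then 1 else 0) *
      (if a = a' then 1 else 0))) fun a a' i i' o o' => sum_codeChoi_right hm h1 hV a a' i i' o o'⟩

/-- Partial transposition turns $Q$ into $F$. Regrouping along $1\pm F$ gives
$\frac1{2m^2}\bigl[\frac{1+F}{m+1}\otimes(1\otimes V^T+mJ^{T_B})+\frac{1-F}{m-1}\otimes(1\otimes
V^T-mJ^{T_B})\bigr]$, with the second term absent when $m=1$. -/
theorem posSemidef_codeChoi_partialTranspose (hm : 1 ≤ m) {J : Matrix (A × B) (A × B) ℂ}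
    {V : Matrix B B ℂ} (hJV : ((1 : Matrix A A ℂ) ⊗ₖ V - J).PosSemidef) (h1 : traceRight J = 1)
    (hV : V.trace = (m : ℂ) ^ 2)
    (hp : ((1 : Matrix A A ℂ) ⊗ₖ Vᵀ + (m : ℂ) • transposeRight J).PosSemidef)
    (hn : ((1 : Matrix A A ℂ) ⊗ₖ Vᵀ - (m : ℂ) • transposeRight J).PosSemidef) :
    (of fun p q : (A × Fin m) × (Fin m × B) =>
      codeChoi m J V ((p.1.1, q.1.2), (p.2.1, q.2.2)) ((q.1.1, p.1.2), (q.2.1, p.2.2)) :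
        Matrix ((A × Fin m) × (Fin m × B)) ((A × Fin m) × (Fin m × B)) ℂ).PosSemidef := by
  have hm1 : (1 : ℝ) ≤ m := by exact_mod_cast hm
  have c1 : (0 : ℝ) ≤ (2 * (m : ℝ) ^ 2)⁻¹ * ((m : ℝ) + 1)⁻¹ := by positivity
  have c2 : (0 : ℝ) ≤ (2 * (m : ℝ) ^ 2)⁻¹ * ((m : ℝ) - 1)⁻¹ :=
    mul_nonneg (by positivity) (inv_nonneg.2 (by linarith))
  let f : (A × Fin m) × (Fin m × B) → Fin m × Fin m := fun p => (p.1.2, p.2.1)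
  let g : (A × Fin m) × (Fin m × B) → A × B := fun p => (p.1.1, p.2.2)
  have e1 := posSemidef_one_add_flip (Fin m) (ε := 1) (by simp) (by simp)
  have e2 := posSemidef_one_add_flip (Fin m) (ε := -1) (by simp) (by simp)
  have h := (((e1.submatrix f).hadamard (hp.submatrix g)).smul c1).add
    (((e2.submatrix f).hadamard (hn.submatrix g)).smul c2)
  refine h.of_apply_eq ?_
  rintro ⟨⟨a, i⟩, ⟨o, b⟩⟩ ⟨⟨a', i'⟩, ⟨o', b'⟩⟩
  have hw := card_sq_sub_one_inv_mul hJV h1 hV (a, b') (a', b)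
  have hv : ((1 : Matrix A A ℂ) ⊗ₖ Vᵀ) (a, b) (a', b') =
    ((1 : Matrix A A ℂ) ⊗ₖ V - J) (a, b') (a', b) + J (a, b') (a', b) := by
    simp
  change codeChoi m J V ((a, i'), (o, b')) ((a', i), (o', b)) = _
  simp only [codeChoi_apply, Matrix.add_apply, Matrix.smul_apply, hadamard_apply,
    submatrix_apply, f, g, Matrix.sub_apply (A := (1 : Matrix A A ℂ) ⊗ₖ Vᵀ), hv, one_apply_prod,
    flip_apply, transposeRight, of_apply, Complex.real_smul, smul_eq_mul]
  rw [if_congr (eq_comm (a := i') (b := i)) rfl rfl, if_congr (eq_comm (a := i') (b := o)) rfl rfl]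
  generalize ((1 : Matrix A A ℂ) ⊗ₖ V - J) (a, b') (a', b) = w at hw ⊢
  generalize J (a, b') (a', b) = j
  push_cast
  by_cases h : m = 1
  · subst h
    have hw0 : w = 0 := by simpa using hw.symm
    simp [Subsingleton.elim i o, Subsingleton.elim i' o, Subsingleton.elim o' o, hw0]
    ring
  · have hm0 : (m : ℂ) ≠ 0 := by
      have : m ≠ 0 := by omega
      exact_mod_cast this
    have hm1 : (m : ℂ) - 1 ≠ 0 := by
      rw [sub_ne_zero]
      exact_mod_cast h
    have hm2 : (m : ℂ) + 1 ≠ 0 := by exact_mod_cast m.succ_ne_zero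
    rw [show (m : ℂ) ^ 2 - 1 = (m - 1) * (m + 1) by ring]
    generalize (if i = i' then (1 : ℂ) else 0) * (if o = o' then 1 else 0) = x
    rw [mul_comm (if o = i' then (1 : ℂ) else 0)]
    generalize (if i = o' then (1 : ℂ) else 0) * (if o = i' then 1 else 0) = y
    field_simp
    ring

end ProgramToCode

/-! ### The value of the programs -/

section Program

variable {A B : Type*} {m : ℕ}

theorem transposeRight_one [DecidableEq A] [DecidableEq B] :
    transposeRight (1 : Matrix (A × B) (A × B) ℂ) = 1 := by
  ext ⟨a, b⟩ ⟨a', b'⟩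
  simp only [transposeRight, of_apply, Matrix.one_apply, Prod.mk.injEq, eq_comm (a := b')]

theorem transposeRight_smul (c : ℂ) (M : Matrix (A × B) (A × B) ℂ) :
    transposeRight (c • M) = c • transposeRight M := rfl

theorem traceRight_sub [Fintype B] (M N : Matrix (A × B) (A × B) ℂ) :
    traceRight (M - N) = traceRight M - traceRight N := by
  ext
  simp [traceRight]

variable [DecidableEq A] [Fintype B] [DecidableEq B]

/-- The completely depolarising channel is a feasible point of both programs. -/
theorem exists_feasible [Nonempty B] (hm : 1 ≤ m) : ∃ (J : Matrix (A × B) (A × B) ℂ)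
    (V : Matrix B B ℂ), 0 ≤ J ∧ traceRight J = 1 ∧ J ≤ (1 : Matrix A A ℂ) ⊗ₖ V ∧
      V.trace = (m : ℂ) ^ 2 ∧
      -((1 : Matrix A A ℂ) ⊗ₖ Vᵀ) ≤ (m : ℂ) • transposeRight J ∧
      (m : ℂ) • transposeRight J ≤ (1 : Matrix A A ℂ) ⊗ₖ Vᵀ := by
  have hm1 : (1 : ℝ) ≤ m := by exact_mod_cast hm
  set n : ℝ := (Fintype.card B : ℝ) with hn
  have hn0 : 0 < n := by rw [hn]; exact_mod_cast Fintype.card_pos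
  have hnc : (Fintype.card B : ℂ) ≠ 0 := by simp
  have hpos : ∀ x : ℝ, 0 ≤ x → ((x : ℂ) • (1 : Matrix (A × B) (A × B) ℂ)).PosSemidef := by
    intro x hx
    have : (0 : ℂ) ≤ (x : ℂ) := by exact_mod_cast hx
    exact PosSemidef.one.smul this
  have hk : ∀ x : ℂ, (1 : Matrix A A ℂ) ⊗ₖ (x • (1 : Matrix B B ℂ)) = x • 1 := by
    intro x
    rw [kronecker_smul, one_kronecker_one]
  -- For scalar matrices the order constraints reduce to $m^2\ge 1$ and $m^2\ge\pm m$.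
  refine ⟨((n⁻¹ : ℝ) : ℂ) • 1, ((m ^ 2 * n⁻¹ : ℝ) : ℂ) • 1, ?_, ?_, ?_, ?_, ?_, ?_⟩
  · exact (hpos _ (by positivity)).nonneg
  · ext a a'
    simp [traceRight, Matrix.one_apply, hn]
  · rw [Matrix.le_iff, hk, ← sub_smul, ← Complex.ofReal_sub]
    refine hpos _ ?_
    have : (m : ℝ) ^ 2 * n⁻¹ - n⁻¹ = (m - 1) * (m + 1) * n⁻¹ := by ring
    rw [this]
    exact mul_nonneg (mul_nonneg (by linarith) (by linarith)) (inv_pos.2 hn0).le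
  · rw [trace_smul, trace_one, smul_eq_mul, hn]
    push_cast
    field_simp
  · rw [Matrix.le_iff, transpose_smul, transpose_one, hk, transposeRight_smul, transposeRight_one,
      smul_smul, sub_neg_eq_add, ← add_smul, ← Complex.ofReal_natCast, ← Complex.ofReal_mul,
      ← Complex.ofReal_add]
    exact hpos _ (by positivity)
  · rw [Matrix.le_iff, transpose_smul, transpose_one, hk, transposeRight_smul, transposeRight_one,
      smul_smul, ← sub_smul, ← Complex.ofReal_natCast, ← Complex.ofReal_mul, ← Complex.ofReal_sub]
    refine hpos _ ?_
    have : (m : ℝ) ^ 2 * n⁻¹ - m * n⁻¹ = m * (m - 1) * n⁻¹ := by ring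
    rw [this]
    exact mul_nonneg (mul_nonneg (by linarith) (by linarith)) (inv_pos.2 hn0).le

variable [Fintype A] [Nonempty A]

theorem simError_le {Ω : Set (SuperOp (A × Fin m) (Fin m × B))} {N : SuperOp A B}
    (hN : IsChannel N) {P : SuperOp (A × Fin m) (Fin m × B)} (hP : P ∈ Ω) {γ : ℝ}
    {Y : Matrix (A × B) (A × B) ℂ} (h1 : traceRight Y ≤ (γ : ℂ) • (1 : Matrix A A ℂ))
    (h2 : choi (plug P (idChannel m)) - choi N ≤ Y) (h3 : 0 ≤ Y)
    (h4 : traceRight (choi (plug P (idChannel m))) = 1) :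
    0 ≤ γ ∧ simError Ω (idChannel m) N ≤ ENNReal.ofReal γ := by
  rw [Matrix.le_iff] at h1 h2
  rw [nonneg_iff_posSemidef] at h3
  have hγ : 0 ≤ γ := by
    obtain ⟨a⟩ := ‹Nonempty A›
    have i1 := (Complex.le_def.1 (h1.diag_nonneg (i := a))).1
    have i2 := (Complex.le_def.1 ((posSemidef_traceRight h3).diag_nonneg (i := a))).1
    simp at i1 i2
    linarith
  refine ⟨hγ, ?_⟩
  have h0 : traceRight (choi (plug P (idChannel m) - N)) = 0 := by
    rw [choi_sub, traceRight_sub, h4, hN.traceRight_choi, sub_self]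
  have h := diamondNorm_le_of_le h0 h1 h3 h2 hγ
  calc simError Ω (idChannel m) N ≤ 2⁻¹ * ENNReal.ofReal (2 * γ) :=
        mul_le_mul_right (iInf₂_le_of_le P hP h) _
    _ = ENNReal.ofReal γ := by
        rw [ENNReal.ofReal_mul zero_le_two, ENNReal.ofReal_ofNat, ← mul_assoc,
          ENNReal.inv_mul_cancel two_ne_zero ENNReal.ofNat_ne_top, one_mul]

/-- If the Choi matrices of the effective channels of the codes in `Ω` are the matrices satisfying
the constraint `C`, the simulation error is the value of the corresponding program. -/
theorem isGLB_simError (Ω : Set (SuperOp (A × Fin m) (Fin m × B))) {N : SuperOp A B}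
    (hN : IsChannel N) (C : Matrix (A × B) (A × B) ℂ → Matrix B B ℂ → Prop)
    (hC : ∀ J V, C J V → 0 ≤ J ∧ traceRight J = 1)
    (hΩ : ∀ P ∈ Ω, ∃ V, C (choi (plug P (idChannel m))) V)
    (hcode : ∀ J V, C J V → ∃ P ∈ Ω, choi (plug P (idChannel m)) = J)
    (hne : ∃ J V, C J V) :
    simError Ω (idChannel m) N ≠ ⊤ ∧
      IsGLB {γ : ℝ | ∃ (Y J : Matrix (A × B) (A × B) ℂ) (V : Matrix B B ℂ),
          traceRight Y ≤ (γ : ℂ) • (1 : Matrix A A ℂ) ∧ J - choi N ≤ Y ∧ 0 ≤ Y ∧ C J V}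
        (simError Ω (idChannel m) N).toReal := by
  have hle : ∀ γ : ℝ, (∃ (Y J : Matrix (A × B) (A × B) ℂ) (V : Matrix B B ℂ),
      traceRight Y ≤ (γ : ℂ) • (1 : Matrix A A ℂ) ∧ J - choi N ≤ Y ∧ 0 ≤ Y ∧ C J V) →
      0 ≤ γ ∧ simError Ω (idChannel m) N ≤ ENNReal.ofReal γ := by
    rintro γ ⟨Y, J, V, h1, h2, h3, h4⟩
    obtain ⟨P, hP, rfl⟩ := hcode J V h4
    exact simError_le hN hP h1 h2 h3 (hC _ _ h4).2
  have htop : simError Ω (idChannel m) N ≠ ⊤ := by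
    obtain ⟨J, V, hJV⟩ := hne
    obtain ⟨hJ, hJ1⟩ := hC J V hJV
    -- The choice $Y=J$, $\gamma=1$ is always feasible, so the error is at most $1$.
    refine ne_top_of_le_ne_top ENNReal.ofReal_ne_top (hle 1 ⟨J, J, V, ?_, ?_, hJ, hJV⟩).2
    · rw [hJ1, Complex.ofReal_one, one_smul]
    · rw [Matrix.le_iff, sub_sub_cancel]
      exact hN.posSemidef_choi
  refine ⟨htop, fun γ hγ => ?_, fun b hb => ?_⟩
  · obtain ⟨h0, h⟩ := hle γ hγ
    exact ENNReal.toReal_le_of_le_ofReal h0 h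
  · rw [← ENNReal.ofReal_le_iff_le_toReal htop]
    have key : ENNReal.ofReal (2 * b) ≤ ⨅ P ∈ Ω, diamondNorm (plug P (idChannel m) - N) := by
      refine le_iInf₂ fun P hP => ?_
      by_cases hd : diamondNorm (plug P (idChannel m) - N) = ⊤
      · rw [hd]
        exact le_top
      obtain ⟨V, hV⟩ := hΩ P hP
      obtain ⟨hJ, hJ1⟩ := hC _ _ hV
      have h0 : traceRight (choi (plug P (idChannel m) - N)) = 0 := by
        rw [choi_sub, traceRight_sub, hJ1, hN.traceRight_choi, sub_self]
      have hherm : (choi (plug P (idChannel m) - N)).IsHermitian := by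
        rw [choi_sub]
        exact (nonneg_iff_posSemidef.1 hJ).isHermitian.sub hN.posSemidef_choi.isHermitian
      have hb2 : b ≤ (diamondNorm (plug P (idChannel m) - N)).toReal / 2 := by
        -- Every `g` strictly above half the diamond norm is feasible, so attainment of the infimum
        -- is not needed.
        refine le_of_forall_gt_imp_ge_of_dense fun g hg => hb ?_
        obtain ⟨Y, hY, hYJ, hYg⟩ := exists_dual_point ENNReal.toReal_nonneg
          (ENNReal.ofReal_toReal hd).ge hherm h0 hg
        exact ⟨Y, _, V, hYg, hYJ, hY.nonneg, hV⟩
      rw [← ENNReal.ofReal_toReal hd]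
      exact ENNReal.ofReal_le_ofReal (by linarith)
    calc ENNReal.ofReal b = 2⁻¹ * ENNReal.ofReal (2 * b) := by
          rw [ENNReal.ofReal_mul zero_le_two, ENNReal.ofReal_ofNat, ← mul_assoc,
            ENNReal.inv_mul_cancel two_ne_zero ENNReal.ofNat_ne_top, one_mul]
      _ ≤ simError Ω (idChannel m) N := mul_le_mul_right key _

end Program

end ChannelSim

end

theorem mainTheorem4 {A B : Type*} [Fintype A] [DecidableEq A] [Nonempty A]
    [Fintype B] [DecidableEq B] [Nonempty B] (m : ℕ) (hm : 1 ≤ m)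
    (N : ChannelSim.SuperOp A B) (hN : ChannelSim.IsChannel N) :
    (ChannelSim.omegaNS m N ≠ ⊤ ∧
      IsGLB {γ : ℝ | ∃ (Y J : Matrix (A × B) (A × B) ℂ) (V : Matrix B B ℂ),
          ChannelSim.traceRight Y ≤ (γ : ℂ) • (1 : Matrix A A ℂ) ∧
          J - ChannelSim.choi N ≤ Y ∧ 0 ≤ Y ∧
          0 ≤ J ∧ ChannelSim.traceRight J = 1 ∧
          J ≤ (1 : Matrix A A ℂ) ⊗ₖ V ∧ V.trace = (m : ℂ) ^ 2}
        (ChannelSim.omegaNS m N).toReal) ∧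
    (ChannelSim.omegaNSPPT m N ≠ ⊤ ∧
      IsGLB {γ : ℝ | ∃ (Y J : Matrix (A × B) (A × B) ℂ) (V : Matrix B B ℂ),
          ChannelSim.traceRight Y ≤ (γ : ℂ) • (1 : Matrix A A ℂ) ∧
          J - ChannelSim.choi N ≤ Y ∧ 0 ≤ Y ∧
          0 ≤ J ∧ ChannelSim.traceRight J = 1 ∧
          J ≤ (1 : Matrix A A ℂ) ⊗ₖ V ∧ V.trace = (m : ℂ) ^ 2 ∧
          -((1 : Matrix A A ℂ) ⊗ₖ V.transpose) ≤ (m : ℂ) • ChannelSim.transposeRight J ∧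
          (m : ℂ) • ChannelSim.transposeRight J ≤ (1 : Matrix A A ℂ) ⊗ₖ V.transpose}
        (ChannelSim.omegaNSPPT m N).toReal) := by
  classical
  obtain ⟨J₀, V₀, f1, f2, f3, f4, f5, f6⟩ := ChannelSim.exists_feasible (A := A) (B := B) hm
  have a₀ : A := Classical.arbitrary A
  refine ⟨ChannelSim.isGLB_simError _ hN (fun J V => 0 ≤ J ∧ ChannelSim.traceRight J = 1 ∧
      J ≤ (1 : Matrix A A ℂ) ⊗ₖ V ∧ V.trace = (m : ℂ) ^ 2) (fun J V h => ⟨h.1, h.2.1⟩) ?_ ?_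
      ⟨J₀, V₀, f1, f2, f3, f4⟩,
    ChannelSim.isGLB_simError _ hN (fun J V => 0 ≤ J ∧ ChannelSim.traceRight J = 1 ∧
      J ≤ (1 : Matrix A A ℂ) ⊗ₖ V ∧ V.trace = (m : ℂ) ^ 2 ∧
      -((1 : Matrix A A ℂ) ⊗ₖ V.transpose) ≤ (m : ℂ) • ChannelSim.transposeRight J ∧
      (m : ℂ) • ChannelSim.transposeRight J ≤ (1 : Matrix A A ℂ) ⊗ₖ V.transpose)
      (fun J V h => ⟨h.1, h.2.1⟩) ?_ ?_ ⟨J₀, V₀, f1, f2, f3, f4, f5, f6⟩⟩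
  · rintro P ⟨hP, hAB, hBA⟩
    exact ⟨ChannelSim.codeMarginal P a₀, (ChannelSim.posSemidef_choi_plug hP).nonneg,
      ChannelSim.traceRight_choi_plug hm hP hBA,
      ChannelSim.posSemidef_one_kronecker_sub_choi_plug hP hAB a₀,
      ChannelSim.trace_codeMarginal hP a₀⟩
  · rintro J V ⟨hJ, h1, hJV, hV⟩
    exact ⟨_, ChannelSim.ofChoi_codeChoi_mem_NSCodes hm (Matrix.nonneg_iff_posSemidef.1 hJ) hJV h1
      hV, ChannelSim.choi_plug_codeChoi hm J V⟩
  · rintro P ⟨⟨hP, hAB, hBA⟩, -, -, hPPT⟩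
    refine ⟨ChannelSim.codeMarginal P a₀, (ChannelSim.posSemidef_choi_plug hP).nonneg,
      ChannelSim.traceRight_choi_plug hm hP hBA,
      ChannelSim.posSemidef_one_kronecker_sub_choi_plug hP hAB a₀,
      ChannelSim.trace_codeMarginal hP a₀, ?_, ?_⟩
    · have h := ChannelSim.posSemidef_one_kronecker_transpose_add hAB
        (Matrix.nonneg_iff_posSemidef.1 hPPT) a₀ (ε := 1) (by simp) (by simp)
      rw [Matrix.le_iff, sub_neg_eq_add, add_comm]
      rwa [one_smul] at h
    · have h := ChannelSim.posSemidef_one_kronecker_transpose_add hAB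
        (Matrix.nonneg_iff_posSemidef.1 hPPT) a₀ (ε := -1) (by simp) (by simp)
      rw [Matrix.le_iff, sub_eq_add_neg]
      rwa [neg_one_smul] at h
  · rintro J V ⟨hJ, h1, hJV, hV, hp, hn⟩
    have hmem := ChannelSim.ofChoi_codeChoi_mem_NSCodes hm (Matrix.nonneg_iff_posSemidef.1 hJ) hJV
      h1 hV
    refine ⟨_, ⟨hmem, hmem.1, hmem.2.2, ?_⟩, ChannelSim.choi_plug_codeChoi hm J V⟩
    rw [Matrix.le_iff, sub_neg_eq_add, add_comm] at hp
    rw [ChannelSim.choi_ofChoi]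
    exact (ChannelSim.posSemidef_codeChoi_partialTranspose hm hJV h1 hV hp hn).nonneg
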